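/- Let $k\ge 0$ and $t\ge 3$ be integers, let $\varepsilon>0$, and let $P:\{0,1\}^k\to\{0,1\}$ be $(t-1)$-wise uniform-supporting, i.e. there is a probability distribution $\mu$ on $\{0,1\}^k$, supported on $P^{-1}(1)$, such that $\Pr_{z\sim\mu}[z_T=\alpha]=2^{-|T|}$ for all $T\subseteq[k]$ with $1\le|T|\le t-1$ and all $\alpha\in\{0,1\}^T$. A random instance $\mathcal I$ of $\mathrm{CSP}(P)$ with $n$ variables and $m$ constraints consists of $m$ pairs $(c,S)$ drawn independently and uniformly, with replacement, from $\{0,1\}^k\times[n]^k$; the pair $(c,S)$ represents the constraint $P(x_S\oplus c)=1$. Its linear relaxation (of the CNF encoding) is $$L_{\mathcal I}=\Big\{x\in[0,1]^n:\ \sum_{i=1}^k x_{S_i}^{(c_i\oplus f_i)}\ge 1\ \text{ for all }(c,S)\in\mathcal I\text{ and all } f\in\{0,1\}^k\text{ with }P(f)=0\Big\},$$ where $a^{(0)}=a$ and $a^{(1)}=1-a$. For $K\subseteq\mathbb R^n$ let $\widetilde K=\{(\lambda,\lambda x_1,\dots,\lambda x_n):\lambda\ge 0,\ x\in K\}\subseteq\mathbb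 R^{n+1}$. Let $N_+(K)$ be the set of all $x\in\mathbb R^n$ for which, with $y=(1,x_1,\dots,x_n)$, there is a symmetric positive semidefinite $(n+1)\times(n+1)$ real matrix $Y$, indexed by $0,\dots,n$, with $Y_{ii}=Y_{i0}=y_i$, $Y_i\in\widetilde K$ and $Y_0-Y_i\in\widetilde K$ for all $0\le i\le n$, where $Y_i$ is the $i$th column of $Y$. Let $N_+^r$ be the $r$-fold iterate of $N_+$. Then there is a constant $c>0$, depending only on $P$, $t$ and $\varepsilon$, such that for every sequence $m=m(n)$ of non-negative integers with $m(n)\le n^{t/2-\varepsilon}$ for all large enough $n$, with probability tending to $1$ as $n\to\infty$ over a random instance $\mathcal I$ with $n$ variables and $m(n)$ constraints, the $r$-round Lovász–Schrijver$_+$ relaxation $N_+^r(L_{\mathcal I})$ is nonempty for every integer $0\le r\le c\,n^{\varepsilon/(t-2)}$. -/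

import Mathlib

open Filter Topology

namespace RandomCSP

/-- The predicate `P : {0,1}^k → {0,1}` is `s`-wise uniform-supporting: there is a probability
distribution `μ` on `{0,1}^k`, supported on satisfying assignments of `P`, whose marginal on every
set `T` of at least one and at most `s` coordinates is uniform. -/
def UniformSupporting {k : ℕ} (P : (Fin k → Bool) → Bool) (s : ℕ) : Prop :=
  ∃ μ ∈ stdSimplex ℝ (Fin k → Bool),
    (∀ z, μ z ≠ 0 → P z = true) ∧
    ∀ T : Finset (Fin k), 1 ≤ T.card → T.card ≤ s → ∀ α : T → Bool,
      ∑ z : Fin k → Bool with (∀ i : T, z i = α i), μ z = (1 / 2 : ℝ) ^ T.card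

/-- A constraint `(c, S)` on `n` variables: a negation pattern `c ∈ {0,1}^k` and an ordered scope
`S ∈ [n]^k`. It stands for `P (x_S ⊕ c) = 1`. -/
abbrev Constraint (k n : ℕ) : Type := (Fin k → Bool) × (Fin k → Fin n)

/-- An instance with `n` variables and `m` constraints (repetitions allowed). -/
abbrev Instance (k n m : ℕ) : Type := Fin m → Constraint k n

/-- The probability of an event for a random instance, whose `m` constraints are drawn independently
and uniformly at random, with replacement, from all `2^k n^k` constraints; equivalently, the
instance is uniform among all sequences of `m` constraints. -/
noncomputable def instanceProb {k n m : ℕ} (E : Instance k n m → Prop) : ℝ :=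
  (Nat.card {I : Instance k n m // E I} : ℝ) / (Nat.card (Instance k n m) : ℝ)

/-- The literal `a^(b)`: it is `a` if `b = 0` and `1 - a` if `b = 1`. -/
def lit (a : ℝ) (b : Bool) : ℝ := if b then 1 - a else a

/-- The linear relaxation of the CNF encoding of an instance: the points of the cube `[0,1]^n` that
satisfy `∑ i, x_{S i}^(c i ⊕ f i) ≥ 1` for all constraints `(c, S)` and all `f` with `P f = 0`. -/
def linRelax {k n m : ℕ} (P : (Fin k → Bool) → Bool) (I : Instance k n m) :
    Set (Fin n → ℝ) :=
  {x | (∀ v, 0 ≤ x v ∧ x v ≤ 1) ∧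
    ∀ j : Fin m, ∀ f : Fin k → Bool, P f = false →
      1 ≤ ∑ i : Fin k, lit (x ((I j).2 i)) (xor ((I j).1 i) (f i))}

/-- The cone `{(λ, λ x_1, …, λ x_n) : λ ≥ 0, x ∈ K}` over `K ⊆ ℝ^n`. -/
def homogCone {n : ℕ} (K : Set (Fin n → ℝ)) : Set (Fin (n + 1) → ℝ) :=
  {y | ∃ l : ℝ, 0 ≤ l ∧ ∃ x ∈ K, y = l • (Fin.cons 1 x : Fin (n + 1) → ℝ)}

/-- The lifted Lovász–Schrijver₊ cone of `C ⊆ ℝ^{n+1}`: all `y` that have a protection matrix `Y`.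
(`Matrix.PosSemidef` includes symmetry.) -/
def liftedCone {n : ℕ} (C : Set (Fin (n + 1) → ℝ)) : Set (Fin (n + 1) → ℝ) :=
  {y | ∃ Y : Matrix (Fin (n + 1)) (Fin (n + 1)) ℝ, Y.PosSemidef ∧
    (∀ i, Y i i = y i ∧ Y i 0 = y i) ∧
    ∀ i, (fun j => Y j i) ∈ C ∧ (fun j => Y j 0 - Y j i) ∈ C}

/-- One Lovász–Schrijver₊ round: the slice `x_0 = 1` of the lifted cone of the cone over `K`. -/
def NPlus {n : ℕ} (K : Set (Fin n → ℝ)) : Set (Fin n → ℝ) :=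
  {x | (Fin.cons 1 x : Fin (n + 1) → ℝ) ∈ liftedCone (homogCone K)}

end RandomCSP

namespace RandomCSP

open Finset

/-! ### Expansion, tight sets of constraints and their closures. -/

section Combinatorics

variable {k n m : ℕ}

/-! The points in the relaxations come from locally consistent distributions on Boolean assignments.
Planting `μ` independently in each constraint of a set gives a product density. By (t-1)-wise
uniformity, a constraint with fewer than `t` positions that are fixed or shared integrates out of it
(`sum_weight_erase`). To describe the variables in `F`, only the constraints in tight sets over `F`
matter. Expansion makes these sets small, so their union `tightClosure` is itself tight and has size
O(|F|/ε), and the local expectations for different `F` agree (`Consistent.localSum_eq`).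

Positive semidefiniteness is the delicate point, since each entry of the moment matrix uses its own
closure. Around every coordinate there is a maximal low-potential set `U` of constraints
(`Consistent.exists_block`). Coordinates whose variables lie in the vertex set `O` of this block
share one genuine nonnegative weight, so their covariance form is nonnegative. A coordinate outside
`O` is uncorrelated with those inside, for otherwise its closure would enlarge `U`. The covariance
matrix thus splits into nonnegative blocks, and the moment matrix is a positive multiple of it plus
a rank-one square (`Consistent.posSemidef`).

Conditioning on a variable being 1 or 0 multiplies the test weight `h` by a coordinate or its
complement and enlarges `F` by at most one variable. The columns required by a Lovász–Schrijver₊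
round are therefore again local points, and induction gives as many rounds as the closure bounds
permit (`Consistent.localPoint_mem_iterate`). A first-moment bound shows that a random instance
expands with high probability up to sets of size of order n^(ε/(t-2)). -/

/-- The variables occurring in the constraints of `A`. -/
def scopeVars (I : Instance k n m) (A : Finset (Fin m)) : Finset (Fin n) :=
  A.biUnion fun c => univ.image (I c).2

/-- The positions of the constraints of `A` that carry the variable `v`. -/
def incidences (I : Instance k n m) (A : Finset (Fin m)) (v : Fin n) : Finset (Fin m × Fin k) :=
  (A ×ˢ univ).filter fun q => (I q.1).2 q.2 = v

/-- The positions of the constraint `c` whose variable is in `V` or occurs at least twice in `A`. -/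
def sharedPositions (I : Instance k n m) (V : Finset (Fin n)) (A : Finset (Fin m)) (c : Fin m) :
    Finset (Fin k) :=
  univ.filter fun p => (I c).2 p ∈ V ∨ 2 ≤ (incidences I A ((I c).2 p)).card

/-- Every constraint of `A` has at least `t` positions shared with `V` or within `A`. -/
def Tight (t : ℕ) (I : Instance k n m) (V : Finset (Fin n)) (A : Finset (Fin m)) : Prop :=
  ∀ c ∈ A, t ≤ (sharedPositions I V A c).card

/-- All sets of at most `s` constraints of the instance have many variables. -/
def Expanding (t : ℕ) (ε : ℝ) (s : ℕ) (I : Instance k n m) : Prop :=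
  ∀ A : Finset (Fin m), A.card ≤ s → (2 * k - t + ε) * A.card ≤ 2 * (scopeVars I A).card

variable {I : Instance k n m} {t : ℕ}

lemma mem_scopeVars {A : Finset (Fin m)} {v : Fin n} :
    v ∈ scopeVars I A ↔ ∃ c ∈ A, ∃ p, (I c).2 p = v := by
  simp [scopeVars]

lemma scopeVars_mem {A : Finset (Fin m)} {c : Fin m} (hc : c ∈ A) (p : Fin k) :
    (I c).2 p ∈ scopeVars I A := mem_scopeVars.2 ⟨c, hc, p, rfl⟩

lemma scopeVars_mono {A B : Finset (Fin m)} (h : A ⊆ B) : scopeVars I A ⊆ scopeVars I B :=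
  biUnion_subset_biUnion_of_subset_left _ h

lemma scopeVars_union (A B : Finset (Fin m)) :
    scopeVars I (A ∪ B) = scopeVars I A ∪ scopeVars I B := union_biUnion

lemma incidences_mono {A B : Finset (Fin m)} (h : A ⊆ B) (v : Fin n) :
    incidences I A v ⊆ incidences I B v :=
  filter_subset_filter _ (product_subset_product_left h)

lemma sharedPositions_mono {V W : Finset (Fin n)} {A B : Finset (Fin m)} (hV : V ⊆ W)
    (h : A ⊆ B) (c : Fin m) : sharedPositions I V A c ⊆ sharedPositions I W B c := by
  intro p hp
  simp only [sharedPositions, mem_filter, mem_univ, true_and] at hp ⊢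
  exact hp.imp (fun h => hV h) fun h' => h'.trans (card_le_card (incidences_mono h _))

lemma Tight.mono {V W : Finset (Fin n)} {A : Finset (Fin m)} (h : Tight t I V A) (hV : V ⊆ W) :
    Tight t I W A :=
  fun c hc => (h c hc).trans (card_le_card (sharedPositions_mono hV Subset.rfl c))

lemma Tight.union {V : Finset (Fin n)} {A B : Finset (Fin m)} (hA : Tight t I V A)
    (hB : Tight t I V B) : Tight t I V (A ∪ B) := by
  intro c hc
  rcases mem_union.1 hc with h | h
  · exact (hA c h).trans (card_le_card (sharedPositions_mono Subset.rfl subset_union_left c))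
  · exact (hB c h).trans (card_le_card (sharedPositions_mono Subset.rfl subset_union_right c))

/-- Double counting of positions: sets of constraints with many shared positions bring in few
variables outside `O`. -/
lemma card_new_vars_le {O : Finset (Fin n)} {B : Finset (Fin m)} (h : Tight t I O B) :
    2 * (scopeVars I B \ O).card + ((B ×ˢ univ).filter fun q => (I q.1).2 q.2 ∈ O).card
      + t * B.card ≤ 2 * k * B.card := by
  classical
  set Q : Finset (Fin m × Fin k) := B ×ˢ univ with hQ
  set a : Fin m × Fin k → ℕ := fun q =>
    if (I q.1).2 q.2 ∈ O then 0
    else 1 + if (incidences I B ((I q.1).2 q.2)).card < 2 then 1 else 0 with ha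
  set b : Fin m × Fin k → ℕ := fun q => if (I q.1).2 q.2 ∈ O then 1 else 0 with hb
  set d : Fin m × Fin k → ℕ := fun q => if q.2 ∈ sharedPositions I O B q.1 then 1 else 0 with hd
  -- Each position carries charge 2. A variable outside `O` collects 2 from its only position, or 1
  -- from each of at least two positions. What is left pays for positions in `O` and for shared
  -- positions.
  have htot : ∑ q ∈ Q, (a q + b q + d q) = 2 * k * B.card := by
    have : ∀ q ∈ Q, a q + b q + d q = 2 := by
      intro q _
      by_cases h1 : (I q.1).2 q.2 ∈ O
      · simp [ha, hb, hd, sharedPositions, h1]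
      · by_cases h2 : (incidences I B ((I q.1).2 q.2)).card < 2
        · have h3 : ¬ 2 ≤ (incidences I B ((I q.1).2 q.2)).card := not_le.2 h2
          simp only [ha, hb, hd, sharedPositions, mem_filter, mem_univ, true_and, h1, h2, h3,
            or_self, if_true, if_false]
        · have h3 : 2 ≤ (incidences I B ((I q.1).2 q.2)).card := not_lt.1 h2
          simp only [ha, hb, hd, sharedPositions, mem_filter, mem_univ, true_and, h1, h2, h3,
            or_true, if_true, if_false]
    rw [sum_congr rfl this, sum_const, hQ, card_product, card_univ, Fintype.card_fin, smul_eq_mul]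
    ring
  have h1 : 2 * (scopeVars I B \ O).card ≤ ∑ q ∈ Q, a q := by
    have hsub : ∑ v ∈ scopeVars I B \ O, ∑ q ∈ incidences I B v, a q ≤ ∑ q ∈ Q, a q := by
      rw [← sum_biUnion]
      · refine sum_le_sum_of_subset ?_
        intro q hq
        obtain ⟨v, _, hq⟩ := mem_biUnion.1 hq
        exact (mem_filter.1 hq).1
      · intro v _ w _ hvw
        refine disjoint_left.2 fun q hq hq' => hvw ?_
        exact (mem_filter.1 hq).2.symm.trans (mem_filter.1 hq').2
    refine le_trans ?_ hsub
    rw [mul_comm, ← smul_eq_mul, ← sum_const]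
    refine sum_le_sum fun v hv => ?_
    rw [Finset.mem_sdiff] at hv
    have hpos : 1 ≤ (incidences I B v).card := by
      obtain ⟨c, hc, p, hp⟩ := mem_scopeVars.1 hv.1
      exact card_pos.2 ⟨(c, p), by simp [incidences, hc, hp]⟩
    have : ∀ q ∈ incidences I B v, a q = 1 + if (incidences I B v).card < 2 then 1 else 0 := by
      intro q hq
      have hq' : (I q.1).2 q.2 = v := (mem_filter.1 hq).2
      simp only [ha, hq', if_neg hv.2]
    rw [sum_congr rfl this, sum_const, smul_eq_mul]
    split_ifs with h2
    · omega
    · omega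
  have h2 : ((Q).filter fun q => (I q.1).2 q.2 ∈ O).card = ∑ q ∈ Q, b q := by
    rw [card_filter]
  have h3 : t * B.card ≤ ∑ q ∈ Q, d q := by
    rw [hQ, sum_product, mul_comm, ← smul_eq_mul, ← sum_const]
    refine sum_le_sum fun c hc => ?_
    have : ∑ p : Fin k, d (c, p) = (sharedPositions I O B c).card := by
      simp [hd]
    rw [this]
    exact h c hc
  rw [sum_add_distrib, sum_add_distrib] at htot
  omega

/-- Discarding `U` loses no shared position: one whose sharing relied on a constraint of `U` carries
a variable of `O`, which now counts as old. -/
lemma Tight.sdiff {V O E : Finset (Fin n)} {A U : Finset (Fin m)} (h : Tight t I V A)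
    (hV : V ⊆ O ∪ E) (hU : scopeVars I U ⊆ O) : Tight t I (O ∪ E) (A \ U) := by
  intro c hc
  refine (h c (Finset.mem_sdiff.1 hc).1).trans (card_le_card fun p hp => ?_)
  simp only [sharedPositions, mem_filter, mem_univ, true_and] at hp ⊢
  by_cases hO : (I c).2 p ∈ O
  · exact Or.inl (mem_union_left _ hO)
  · refine hp.imp (fun h => hV h) fun h2 => h2.trans (card_le_card ?_)
    intro q hq
    simp only [incidences, mem_filter, mem_product, mem_univ, and_true, Finset.mem_sdiff] at hq ⊢
    refine ⟨⟨hq.1, fun hqU => hO ?_⟩, hq.2⟩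
    rw [← hq.2]
    exact hU (scopeVars_mem hqU _)

/-- Tightness bounds the number of variables from above and expansion bounds it from below; the gap
between the two is ε per constraint. -/
lemma Tight.card_le {ε : ℝ} {s : ℕ} (hI : Expanding t ε s I) {V : Finset (Fin n)}
    {A : Finset (Fin m)} (hA : Tight t I V A) (hs : A.card ≤ s) : ε * A.card ≤ 2 * V.card := by
  have h1 := card_new_vars_le hA
  have h2 := hI A hs
  have h3 : (scopeVars I A).card ≤ (scopeVars I A \ V).card + V.card := by
    rw [← Nat.sub_le_iff_le_add]; exact le_card_sdiff _ _
  have h4 : 2 * (scopeVars I A).card + t * A.card ≤ 2 * k * A.card + 2 * V.card := by omega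
  have h5 : (2 * (scopeVars I A).card + t * A.card : ℝ) ≤ 2 * k * A.card + 2 * V.card := by
    exact_mod_cast h4
  linarith

/-- If a set `A` tight relative to old variables and at most one new variable touches the old
variables outside `U`, adding it to `U` does not increase the potential. -/
lemma card_union_vars_le {V O E : Finset (Fin n)} {A U : Finset (Fin m)} (h : Tight t I V A)
    (hV : V ⊆ O ∪ E) (hU : scopeVars I U ⊆ O) (hE : E.card ≤ 1)
    (htouch : E.Nonempty → ∃ v ∈ scopeVars I (A \ U), v ∈ O) :
    2 * (scopeVars I (A \ U) ∪ O).card + t * (A \ U).card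
      ≤ 2 * O.card + 2 * k * (A \ U).card := by
  classical
  have h1 := card_new_vars_le (h.sdiff hV hU)
  set B := A \ U
  have h2 : (scopeVars I B ∪ O).card
      ≤ (scopeVars I B \ (O ∪ E)).card + O.card + (scopeVars I B ∩ (E \ O)).card := by
    have : scopeVars I B ∪ O
        ⊆ (scopeVars I B \ (O ∪ E)) ∪ O ∪ (scopeVars I B ∩ (E \ O)) := by
      intro v hv
      simp only [mem_union, Finset.mem_sdiff, mem_inter] at hv ⊢
      tauto
    exact (card_le_card this).trans ((card_union_le _ _).trans
      (Nat.add_le_add_right (card_union_le _ _) _))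
  -- If the new variable occurs in `B`, it occupies one position counted on the right and the
  -- touching variable of `O` occupies another. These two positions pay for the two units that the
  -- new variable costs.
  have h3 : 2 * (scopeVars I B ∩ (E \ O)).card
      ≤ ((B ×ˢ univ).filter fun q => (I q.1).2 q.2 ∈ O ∪ E).card := by
    have hle : (scopeVars I B ∩ (E \ O)).card ≤ 1 :=
      (card_le_card (inter_subset_right.trans sdiff_subset)).trans hE
    rcases Nat.eq_zero_or_pos (scopeVars I B ∩ (E \ O)).card with h0 | h0
    · omega
    · obtain ⟨w, hw⟩ := card_pos.1 h0
      simp only [mem_inter, Finset.mem_sdiff] at hw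
      obtain ⟨v, hv, hvO⟩ := htouch ⟨w, hw.2.1⟩
      obtain ⟨c, hc, p, hp⟩ := mem_scopeVars.1 hv
      obtain ⟨c', hc', p', hp'⟩ := mem_scopeVars.1 hw.1
      have hne : (c, p) ≠ (c', p') := by
        intro he
        obtain ⟨rfl, rfl⟩ := Prod.mk.inj he
        exact hw.2.2 (hp' ▸ hp ▸ hvO)
      have : ({(c, p), (c', p')} : Finset (Fin m × Fin k)) ⊆
          (B ×ˢ univ).filter fun q => (I q.1).2 q.2 ∈ O ∪ E := by
        intro q hq
        rcases mem_insert.1 hq with rfl | hq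
        · simp [hc, hp, hvO]
        · rw [mem_singleton.1 hq]; simp [hc', hp', hw.2.1]
      have := card_le_card this
      rw [card_pair hne] at this
      omega
  omega

/-- The union of all tight sets of at most `s` constraints. -/
noncomputable def tightClosure (t s : ℕ) (I : Instance k n m) (V : Finset (Fin n)) :
    Finset (Fin m) := by
  classical
  exact (univ.filter fun A : Finset (Fin m) => A.card ≤ s ∧ Tight t I V A).biUnion id

lemma subset_tightClosure {s : ℕ} {V : Finset (Fin n)} {A : Finset (Fin m)} (h : Tight t I V A)
    (hs : A.card ≤ s) : A ⊆ tightClosure t s I V := by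
  classical
  intro c hc
  simp only [tightClosure, mem_biUnion, mem_filter, mem_univ, true_and, id]
  exact ⟨A, ⟨hs, h⟩, hc⟩

lemma tightClosure_mono {s : ℕ} {V W : Finset (Fin n)} (h : V ⊆ W) :
    tightClosure t s I V ⊆ tightClosure t s I W := by
  classical
  intro c hc
  simp only [tightClosure, mem_biUnion, mem_filter, mem_univ, true_and, id] at hc ⊢
  obtain ⟨A, ⟨h1, h2⟩, h3⟩ := hc
  exact ⟨A, ⟨h1, h2.mono h⟩, h3⟩

/-- A union of two tight sets of size at most `s` is tight and has size at most 4|V|/ε ≤ s. Unions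
thus never cross the threshold, and `Tight.card_le` then sharpens the bound to 2|V|/ε. -/
lemma tightClosure_spec {ε : ℝ} (hε : 0 < ε) {s : ℕ} (hI : Expanding t ε s I) {V : Finset (Fin n)}
    (hV : 4 * V.card ≤ ε * s) :
    Tight t I V (tightClosure t s I V) ∧ ε * (tightClosure t s I V).card ≤ 2 * V.card := by
  classical
  have key : ∀ T : Finset (Finset (Fin m)), (∀ A ∈ T, A.card ≤ s ∧ Tight t I V A) →
      Tight t I V (T.biUnion id) ∧ (T.biUnion id).card ≤ s := by
    intro T
    induction T using Finset.induction_on with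
    | empty => intro _; simp [Tight]
    | insert A T hA ih =>
      intro h
      obtain ⟨h1, h2⟩ := ih fun B hB => h B (mem_insert_of_mem hB)
      obtain ⟨h3, h4⟩ := h A (mem_insert_self _ _)
      rw [biUnion_insert, id]
      refine ⟨h4.union h1, ?_⟩
      have e1 := h1.card_le hI h2
      have e2 := h4.card_le hI h3
      have e3 : ((A ∪ T.biUnion id).card : ℝ) ≤ A.card + (T.biUnion id).card := by
        exact_mod_cast card_union_le _ _
      have e4 : ε * ((A ∪ T.biUnion id).card : ℝ) ≤ ε * s := by nlinarith
      exact_mod_cast le_of_mul_le_mul_left e4 hε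
  obtain ⟨h1, h2⟩ := key (univ.filter fun A : Finset (Fin m) => A.card ≤ s ∧ Tight t I V A)
    fun A hA => (mem_filter.1 hA).2
  exact ⟨h1, Tight.card_le hI h1 h2⟩

end Combinatorics

/-! ### Planted densities: integrating out constraints, and independence. -/

section Weights

variable {k n m : ℕ}

/-- Nonnegativity together with uniformity of all marginals on fewer than `t` coordinates. -/
def LocallyUniform (t : ℕ) (μ : (Fin k → Bool) → ℝ) : Prop :=
  (∀ z, 0 ≤ μ z) ∧ ∀ T : Finset (Fin k), T.card < t → ∀ α : Fin k → Bool,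
    ∑ z : Fin k → Bool with (∀ i ∈ T, z i = α i), μ z = (1 / 2 : ℝ) ^ T.card

lemma UniformSupporting.exists_locallyUniform {t : ℕ} {P : (Fin k → Bool) → Bool}
    (h : UniformSupporting P (t - 1)) :
    ∃ μ, LocallyUniform t μ ∧ ∀ z, μ z ≠ 0 → P z = true := by
  obtain ⟨μ, hμ, hsupp, hunif⟩ := h
  refine ⟨μ, ⟨hμ.1, fun T hT α => ?_⟩, hsupp⟩
  rcases Nat.eq_zero_or_pos T.card with h0 | h0
  · rw [h0, pow_zero, ← hμ.2, card_eq_zero.1 h0]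
    simp
  · rw [← hunif T h0 (by omega) fun i => α i]
    refine sum_congr ?_ fun _ _ => rfl
    ext z
    simp

/-- The density of the planted distribution of a single constraint. -/
def planted (μ : (Fin k → Bool) → ℝ) (I : Instance k n m) (c : Fin m) (x : Fin n → Bool) : ℝ :=
  2 ^ k * μ fun p => xor ((I c).1 p) (x ((I c).2 p))

/-- The density of the planted distribution of a set of constraints. -/
def weight (μ : (Fin k → Bool) → ℝ) (I : Instance k n m) (A : Finset (Fin m))
    (x : Fin n → Bool) : ℝ :=
  ∏ c ∈ A, planted μ I c x

variable {I : Instance k n m} {t : ℕ} {μ : (Fin k → Bool) → ℝ}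

lemma weight_nonneg (hμ : LocallyUniform t μ) (A : Finset (Fin m)) (x : Fin n → Bool) :
    0 ≤ weight μ I A x :=
  prod_nonneg fun _ _ => mul_nonneg (by positivity) (hμ.1 _)

lemma dependsOn_weight (A : Finset (Fin m)) :
    DependsOn (weight μ I A) (scopeVars I A : Set (Fin n)) := by
  intro x y h
  refine prod_congr rfl fun c hc => ?_
  unfold planted
  congr 2
  funext p
  rw [h _ (scopeVars_mem hc p)]

/-- Every `z` agreeing with `α` on `T` arises from 2^|T| choices of `y`, and such `z` have total
mass 2^(-|T|). -/
lemma sum_flip (hμ : LocallyUniform t μ) {T : Finset (Fin k)} (hT : T.card < t)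
    (α : Fin k → Bool) :
    ∑ y : Fin k → Bool, μ (fun p => if p ∈ T then α p else xor (α p) (y p)) = 1 := by
  classical
  have hfib : ∀ z : Fin k → Bool,
      ((univ : Finset (Fin k → Bool)).filter fun y =>
        (fun p => if p ∈ T then α p else xor (α p) (y p)) = z).card
        = if ∀ i ∈ T, z i = α i then 2 ^ T.card else 0 := by
    intro z
    split_ifs with hz
    · have : ((univ : Finset (Fin k → Bool)).filter fun y =>
          (fun p => if p ∈ T then α p else xor (α p) (y p)) = z)
          = Fintype.piFinset fun p => if p ∈ T then univ else {xor (α p) (z p)} := by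
        ext y
        simp only [mem_filter, mem_univ, true_and, Fintype.mem_piFinset, funext_iff]
        refine forall_congr' fun p => ?_
        by_cases hp : p ∈ T
        · simp [hp, hz p hp]
        · simp only [hp, if_false, mem_singleton]
          cases α p <;> cases y p <;> cases z p <;> simp
      rw [this, Fintype.card_piFinset]
      have : ∀ p : Fin k, (if p ∈ T then (univ : Finset Bool) else {xor (α p) (z p)}).card
          = if p ∈ T then 2 else 1 := by
        intro p; split_ifs <;> simp
      simp only [this]
      simp
    · refine card_eq_zero.2 (filter_eq_empty_iff.2 fun y _ hy => hz fun i hi => ?_)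
      rw [← hy]; simp [hi]
  calc ∑ y : Fin k → Bool, μ (fun p => if p ∈ T then α p else xor (α p) (y p))
      = ∑ z : Fin k → Bool, ∑ y : Fin k → Bool with
          (fun p => if p ∈ T then α p else xor (α p) (y p)) = z,
          μ (fun p => if p ∈ T then α p else xor (α p) (y p)) := by
        rw [sum_fiberwise]
    _ = ∑ z : Fin k → Bool, (if ∀ i ∈ T, z i = α i then 2 ^ T.card else 0 : ℕ) * μ z := by
        refine sum_congr rfl fun z _ => ?_
        rw [← hfib z, ← nsmul_eq_mul, ← sum_const]
        refine sum_congr rfl fun y hy => ?_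
        rw [(mem_filter.1 hy).2]
    _ = 2 ^ T.card * ∑ z : Fin k → Bool with (∀ i ∈ T, z i = α i), μ z := by
        rw [sum_filter, mul_sum]
        refine sum_congr rfl fun z _ => ?_
        split_ifs <;> simp
    _ = 1 := by rw [hμ.2 T hT α, ← mul_pow]; norm_num

/-- A constraint with fewer than `t` shared positions integrates out of the weight. -/
lemma sum_weight_erase (hμ : LocallyUniform t μ) {V : Finset (Fin n)} {A : Finset (Fin m)}
    {c : Fin m} (hc : c ∈ A) (hsh : (sharedPositions I V A c).card < t) {h : (Fin n → Bool) → ℝ}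
    (hh : DependsOn h (V ∪ scopeVars I (A.erase c) : Set (Fin n))) :
    ∑ x, h x * weight μ I A x = ∑ x, h x * weight μ I (A.erase c) x := by
  classical
  set T := sharedPositions I V A c with hT
  have hmem : ∀ p, p ∈ T ↔ (I c).2 p ∈ V ∨ 2 ≤ (incidences I A ((I c).2 p)).card := by
    intro p; simp [hT, sharedPositions]
  have huniq : ∀ p, p ∉ T → ∀ c' ∈ A, ∀ p', (I c').2 p' = (I c).2 p → c' = c ∧ p' = p := by
    intro p hp c' hc' p' he
    have h1 := mt (hmem p).2 hp
    push Not at h1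
    have h2 : (incidences I A ((I c).2 p)).card ≤ 1 := by omega
    have := card_le_one.1 h2 (c', p') (by simp [incidences, hc', he]) (c, p)
      (by simp [incidences, hc])
    exact Prod.mk.inj this
  -- `τ y` flips the variables at the unshared positions of `c` according to `y`. It is a bijection
  -- invisible to `h` and to the other constraints, so the sum may be averaged over `y`.
  let τ : (Fin k → Bool) → (Fin n → Bool) → (Fin n → Bool) := fun y x v =>
    xor (x v) (decide (∃ p, p ∉ T ∧ (I c).2 p = v ∧ y p = true))
  have hτ : ∀ y, Function.Involutive (τ y) := by
    intro y x
    funext v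
    simp [τ]
  have hfix : ∀ y x v, v ∈ V ∨ v ∈ scopeVars I (A.erase c) → τ y x v = x v := by
    intro y x v hv
    have : ¬ ∃ p, p ∉ T ∧ (I c).2 p = v ∧ y p = true := by
      rintro ⟨p, hp, rfl, -⟩
      rcases hv with hv | hv
      · exact hp ((hmem p).2 (Or.inl hv))
      · obtain ⟨c', hc', p', he⟩ := mem_scopeVars.1 hv
        exact (mem_erase.1 hc').1 (huniq p hp c' (mem_erase.1 hc').2 p' he).1
    simp [τ, this]
  have hval : ∀ y x p, τ y x ((I c).2 p)
      = if p ∈ T then x ((I c).2 p) else xor (x ((I c).2 p)) (y p) := by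
    intro y x p
    split_ifs with hp
    · have : ¬ ∃ p', p' ∉ T ∧ (I c).2 p' = (I c).2 p ∧ y p' = true := by
        rintro ⟨p', hp', he, -⟩
        exact hp' ((huniq p' hp' c hc p he.symm).2 ▸ hp)
      simp [τ, this]
    · have : (∃ p', p' ∉ T ∧ (I c).2 p' = (I c).2 p ∧ y p' = true) ↔ y p = true := by
        constructor
        · rintro ⟨p', hp', he, hy⟩
          rwa [← (huniq p hp c hc p' he).2]
        · intro hy
          exact ⟨p, hp, rfl, hy⟩
      simp [τ, this]
  set H : (Fin n → Bool) → ℝ := fun x => h x * weight μ I (A.erase c) x with hH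
  have hHτ : ∀ y x, H (τ y x) = H x := by
    intro y x
    simp only [hH]
    congr 1
    · exact hh fun v hv => hfix y x v (by simpa using hv)
    · exact dependsOn_weight _ fun v hv => hfix y x v (Or.inr hv)
  have hsplit : ∀ x, h x * weight μ I A x = H x * planted μ I c x := by
    intro x
    simp only [hH, weight]
    rw [← mul_prod_erase A _ hc]
    ring
  have havg : ∀ y, ∑ x, H x * planted μ I c x = ∑ x, H x * planted μ I c (τ y x) := by
    intro y
    rw [← Equiv.sum_comp ((hτ y).toPerm (τ y))]
    refine sum_congr rfl fun x _ => ?_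
    simp [hHτ]
  have hone : ∀ x, ∑ y, planted μ I c (τ y x) = 2 ^ k := by
    intro x
    simp only [planted, ← mul_sum, hval]
    have := sum_flip hμ hsh fun p => xor ((I c).1 p) (x ((I c).2 p))
    nth_rw 2 [← mul_one ((2 : ℝ) ^ k)]
    rw [← this]
    congr 1
    refine sum_congr rfl fun y _ => ?_
    congr 1
    funext p
    split_ifs <;> simp
  have htwo : (2 : ℝ) ^ k * ∑ x, H x * planted μ I c x = 2 ^ k * ∑ x, H x := by
    calc (2 : ℝ) ^ k * ∑ x, H x * planted μ I c x
        = ∑ y : Fin k → Bool, ∑ x, H x * planted μ I c (τ y x) := by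
          rw [← sum_congr rfl fun y _ => havg y]
          simp
      _ = ∑ x, H x * ∑ y : Fin k → Bool, planted μ I c (τ y x) := by
          rw [sum_comm]; simp only [mul_sum]
      _ = 2 ^ k * ∑ x, H x := by
          simp only [hone]; rw [← sum_mul, mul_comm]
  rw [sum_congr rfl fun x _ => hsplit x]
  exact mul_left_cancel₀ (by positivity) htwo

/-- Stripping down to `C`: all tight sets between `C` and `U` equal `C`. -/
lemma sum_weight_eq (hμ : LocallyUniform t μ) {V : Finset (Fin n)} {C : Finset (Fin m)}
    (hC : Tight t I V C) {h : (Fin n → Bool) → ℝ}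
    (hh : DependsOn h (V ∪ scopeVars I C : Set (Fin n))) (U : Finset (Fin m)) (hCU : C ⊆ U)
    (hmax : ∀ A, A ⊆ U → Tight t I V A → A ⊆ C) :
    ∑ x, h x * weight μ I U x = ∑ x, h x * weight μ I C x := by
  classical
  induction U using Finset.strongInduction with
  | H U ih =>
    by_cases hU : Tight t I V U
    · rw [Subset.antisymm (hmax U Subset.rfl hU) hCU]
    · unfold Tight at hU
      push Not at hU
      obtain ⟨c, hc, hlt⟩ := hU
      have hcC : c ∉ C := fun hcC =>
        absurd ((hC c hcC).trans (card_le_card (sharedPositions_mono Subset.rfl hCU c)))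
          (not_le.2 hlt)
      have hCe : C ⊆ U.erase c := fun d hd =>
        mem_erase.2 ⟨fun he => hcC (he ▸ hd), hCU hd⟩
      rw [sum_weight_erase hμ hc hlt (hh.mono (Set.union_subset_union_right _
        (coe_subset.2 (scopeVars_mono hCe))))]
      exact ih _ (erase_ssubset hc) hCe fun A hA => hmax A (hA.trans (erase_subset _ _))

/-- Independence of functions of disjoint sets of variables, in cross-multiplied form. -/
lemma sum_mul_sum_swap {O : Finset (Fin n)} {f f' g g' : (Fin n → Bool) → ℝ}
    (hf : DependsOn f (O : Set (Fin n))) (hf' : DependsOn f' (O : Set (Fin n)))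
    (hg : DependsOn g (O : Set (Fin n))ᶜ) (hg' : DependsOn g' (O : Set (Fin n))ᶜ) :
    (∑ x, f x * g x) * ∑ x, f' x * g' x = (∑ x, f x * g' x) * ∑ x, f' x * g x := by
  classical
  -- Two independent copies exchange their values on `O`.
  let σ : (Fin n → Bool) × (Fin n → Bool) → (Fin n → Bool) × (Fin n → Bool) := fun z =>
    (fun v => if v ∈ O then z.1 v else z.2 v, fun v => if v ∈ O then z.2 v else z.1 v)
  have hσ : Function.Involutive σ := by
    rintro ⟨x, y⟩
    refine Prod.ext ?_ ?_ <;> funext v <;> by_cases hv : v ∈ O <;> simp [σ, hv]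
  rw [sum_mul_sum, sum_mul_sum, ← Fintype.sum_prod_type', ← Fintype.sum_prod_type',
    ← Equiv.sum_comp (hσ.toPerm σ)]
  refine sum_congr rfl fun z _ => ?_
  have e1 : f (σ z).1 = f z.1 := hf fun v hv => by simp [σ, mem_coe.1 hv]
  have e2 : f' (σ z).2 = f' z.2 := hf' fun v hv => by simp [σ, mem_coe.1 hv]
  have e3 : g (σ z).1 = g z.2 := hg fun v hv => by
    have : v ∉ O := hv
    simp [σ, this]
  have e4 : g' (σ z).2 = g' z.1 := hg' fun v hv => by
    have : v ∉ O := hv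
    simp [σ, this]
  simp only [Function.Involutive.coe_toPerm, e1, e2, e3, e4]
  ring

end Weights

/-! ### Local expectations and positive semidefiniteness of moment matrices. -/

section PseudoExpectation

variable {k n m : ℕ}

/-- The homogenized indicator vector `(1, x)` of a Boolean assignment. -/
def homogCoord (x : Fin n → Bool) : Fin (n + 1) → ℝ :=
  Fin.cons 1 fun v => if x v then 1 else 0

/-- The variable underlying a homogenized coordinate, if any. -/
def coordVars : Fin (n + 1) → Finset (Fin n) :=
  Fin.cons ∅ fun v => {v}

lemma homogCoord_zero (x : Fin n → Bool) : homogCoord x 0 = 1 := rfl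

lemma homogCoord_eq (x : Fin n → Bool) (i : Fin (n + 1)) :
    homogCoord x i = 0 ∨ homogCoord x i = 1 := by
  refine Fin.cases (Or.inr rfl) (fun v => ?_) i
  simp only [homogCoord, Fin.cons_succ]
  split_ifs <;> simp

lemma homogCoord_nonneg (x : Fin n → Bool) (i : Fin (n + 1)) : 0 ≤ homogCoord x i := by
  rcases homogCoord_eq x i with h | h <;> simp [h]

lemma homogCoord_le_one (x : Fin n → Bool) (i : Fin (n + 1)) : homogCoord x i ≤ 1 := by
  rcases homogCoord_eq x i with h | h <;> simp [h]

lemma homogCoord_mul_self (x : Fin n → Bool) (i : Fin (n + 1)) :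
    homogCoord x i * homogCoord x i = homogCoord x i := by
  rcases homogCoord_eq x i with h | h <;> simp [h]

lemma coordVars_zero : (coordVars 0 : Finset (Fin n)) = ∅ := rfl

lemma card_coordVars_le (i : Fin (n + 1)) : (coordVars i : Finset (Fin n)).card ≤ 1 := by
  refine Fin.cases (by simp [coordVars]) (fun v => by simp [coordVars]) i

lemma homogCoord_congr {x y : Fin n → Bool} (i : Fin (n + 1))
    (h : ∀ v ∈ coordVars i, x v = y v) : homogCoord x i = homogCoord y i := by
  revert h
  refine Fin.cases (fun _ => rfl) (fun v h => ?_) i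
  have : x v = y v := h v (by simp [coordVars])
  simp [homogCoord, this]

/-- The parameters for which local distributions on at most `b` variables are consistent. -/
structure Consistent (t : ℕ) (ε : ℝ) (s b : ℕ) (μ : (Fin k → Bool) → ℝ) (I : Instance k n m) :
    Prop where
  unif : LocallyUniform t μ
  eps_pos : 0 < ε
  expanding : Expanding t ε s I
  size : 4 * b + ε ≤ ε * s

/-- The unnormalized local expectation of functions of the variables in `F`. -/
noncomputable def localSum (t s : ℕ) (μ : (Fin k → Bool) → ℝ) (I : Instance k n m)
    (F : Finset (Fin n)) (h : (Fin n → Bool) → ℝ) : ℝ :=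
  ∑ x, h x * weight μ I (tightClosure t s I F) x

variable {I : Instance k n m} {t s b : ℕ} {ε : ℝ} {μ : (Fin k → Bool) → ℝ}
  {F : Finset (Fin n)} {h : (Fin n → Bool) → ℝ}

namespace Consistent

lemma closure_spec (H : Consistent t ε s b μ I) (hF : F.card ≤ b) :
    Tight t I F (tightClosure t s I F) ∧ ε * (tightClosure t s I F).card ≤ 2 * b := by
  have hF' : (F.card : ℝ) ≤ b := by exact_mod_cast hF
  have := H.size
  have := H.eps_pos
  obtain ⟨h1, h2⟩ := tightClosure_spec H.eps_pos H.expanding (V := F) (by linarith)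
  exact ⟨h1, by linarith⟩

lemma card_le_of_mul_le (H : Consistent t ε s b μ I) {N : ℕ} (hN : ε * N ≤ 4 * b + ε) : N ≤ s := by
  exact_mod_cast le_of_mul_le_mul_left (hN.trans H.size) H.eps_pos

lemma card_closure_le (H : Consistent t ε s b μ I) (hF : F.card ≤ b) :
    (tightClosure t s I F).card ≤ s := by
  refine H.card_le_of_mul_le ?_
  have := (H.closure_spec hF).2
  have := H.eps_pos
  have : (0 : ℝ) ≤ b := by positivity
  linarith

/-- Any tight subset of `U` has size at most `s`, hence lies in the closure, so everything beyond
the closure strips off. This lets different entries be computed with one common weight. -/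
lemma sum_eq_localSum (H : Consistent t ε s b μ I) (hF : F.card ≤ b)
    (hh : DependsOn h (F : Set (Fin n))) {U : Finset (Fin m)} (hU : tightClosure t s I F ⊆ U)
    (hs : U.card ≤ s) : ∑ x, h x * weight μ I U x = localSum t s μ I F h :=
  sum_weight_eq H.unif (H.closure_spec hF).1 (hh.mono Set.subset_union_left) U hU
    fun _ hA hT => subset_tightClosure hT ((card_le_card hA).trans hs)

lemma localSum_eq (H : Consistent t ε s b μ I) {F' : Finset (Fin n)} (hF' : F'.card ≤ b)
    (hFF' : F ⊆ F') (hh : DependsOn h (F : Set (Fin n))) :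
    localSum t s μ I F' h = localSum t s μ I F h :=
  H.sum_eq_localSum ((card_le_card hFF').trans hF') hh (tightClosure_mono hFF')
    (H.card_closure_le hF')

lemma localSum_nonneg (H : Consistent t ε s b μ I) (h0 : ∀ x, 0 ≤ h x) :
    0 ≤ localSum t s μ I F h :=
  sum_nonneg fun x _ => mul_nonneg (h0 x) (weight_nonneg H.unif _ x)

lemma localSum_mono (H : Consistent t ε s b μ I) {h' : (Fin n → Bool) → ℝ}
    (hle : ∀ x, h x ≤ h' x) : localSum t s μ I F h ≤ localSum t s μ I F h' :=
  sum_le_sum fun x _ => mul_le_mul_of_nonneg_right (hle x) (weight_nonneg H.unif _ x)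

end Consistent

/-- The second moment matrix of the homogenized coordinates under the local expectation weighted by
`h`. -/
noncomputable def momentMatrix (t s : ℕ) (μ : (Fin k → Bool) → ℝ) (I : Instance k n m)
    (F : Finset (Fin n)) (h : (Fin n → Bool) → ℝ) : Matrix (Fin (n + 1)) (Fin (n + 1)) ℝ :=
  fun i j => localSum t s μ I (F ∪ coordVars i ∪ coordVars j)
    fun x => h x * homogCoord x i * homogCoord x j

lemma momentMatrix_comm (i j : Fin (n + 1)) :
    momentMatrix t s μ I F h i j = momentMatrix t s μ I F h j i := by
  simp only [momentMatrix, union_right_comm F (coordVars i), mul_right_comm _ (homogCoord _ i)]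

lemma momentMatrix_self (i : Fin (n + 1)) :
    momentMatrix t s μ I F h i i = momentMatrix t s μ I F h i 0 := by
  simp [momentMatrix, coordVars_zero, homogCoord_zero, union_assoc, mul_assoc,
    homogCoord_mul_self]

lemma momentMatrix_zero_zero :
    momentMatrix t s μ I F h 0 0 = localSum t s μ I F h := by
  simp [momentMatrix, coordVars_zero, homogCoord_zero]

lemma dependsOn_mul_coord (hh : DependsOn h (F : Set (Fin n))) (i : Fin (n + 1)) :
    DependsOn (fun x => h x * homogCoord x i) ((F ∪ coordVars i : Finset (Fin n)) : Set (Fin n)) := by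
  intro x y hxy
  have e1 : h x = h y := hh fun v hv => hxy v (by simp [mem_coe.1 hv])
  have e2 := homogCoord_congr (x := x) (y := y) i fun v hv => hxy v (by simp [hv])
  simp only [e1, e2]

/-- A quadratic form is nonnegative if every index lies in a block that decouples from its
complement and on which the form is nonnegative. -/
lemma quadForm_nonneg_of_blocks {ι : Type*} [Fintype ι] [DecidableEq ι] {M : ι → ι → ℝ}
    (hM : ∀ i j, M i j = M j i)
    (hblock : ∀ i, ∃ Q : Finset ι, i ∈ Q ∧ (∀ j ∈ Q, ∀ l ∉ Q, M j l = 0) ∧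
      ∀ a : ι → ℝ, 0 ≤ ∑ j ∈ Q, ∑ l ∈ Q, a j * a l * M j l) (a : ι → ℝ) :
    0 ≤ ∑ j, ∑ l, a j * a l * M j l := by
  suffices hS : ∀ (S : Finset ι) (a : ι → ℝ), (∀ i ∉ S, a i = 0) →
      0 ≤ ∑ j, ∑ l, a j * a l * M j l from hS univ a fun i hi => absurd (mem_univ i) hi
  intro S
  induction S using Finset.strongInduction with
  | H S ih =>
    intro a ha
    rcases S.eq_empty_or_nonempty with rfl | ⟨i, hi⟩
    · simp [fun i => ha i (notMem_empty i)]
    · obtain ⟨Q, hiQ, hzero, hQ⟩ := hblock i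
      have hne : S \ Q ≠ S := fun he => by
        have hi' : i ∈ S \ Q := he.symm ▸ hi
        exact (Finset.mem_sdiff.1 hi').2 hiQ
      -- Setting `a` to zero on `Q` removes only the form on `Q`, since the cross terms vanish. The
      -- blocks need not be disjoint.
      have h1 := ih (S \ Q) (Finset.ssubset_iff_subset_ne.2 ⟨sdiff_subset, hne⟩) (fun j => if j ∈ Q then 0 else a j) (by
        intro j hj
        by_cases hjQ : j ∈ Q
        · simp [hjQ]
        · simp only [hjQ, if_false]
          exact ha j fun hjS => hj (Finset.mem_sdiff.2 ⟨hjS, hjQ⟩))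
      have h2 := hQ a
      have h3 : ∑ j ∈ Q, ∑ l ∈ Q, a j * a l * M j l
          = ∑ j, ∑ l, if j ∈ Q then (if l ∈ Q then a j * a l * M j l else 0) else 0 := by
        have : ∀ j, (∑ l, if j ∈ Q then (if l ∈ Q then a j * a l * M j l else 0) else 0)
            = if j ∈ Q then ∑ l ∈ Q, a j * a l * M j l else 0 := by
          intro j; split_ifs <;> simp
        simp [this]
      rw [h3] at h2
      refine (add_nonneg h1 h2).trans_eq ?_
      rw [← sum_add_distrib]
      refine sum_congr rfl fun j _ => ?_
      rw [← sum_add_distrib]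
      refine sum_congr rfl fun l _ => ?_
      by_cases hj : j ∈ Q <;> by_cases hl : l ∈ Q
      · simp [hj, hl]
      · simp [hj, hl, hzero j hj l hl]
      · simp [hj, hl, hM j l, hzero l hl j hj]
      · simp [hj, hl]

/-- A maximal low-potential set of constraints around a coordinate. -/
lemma Consistent.exists_block (H : Consistent t ε s b μ I) (hF : F.card + 2 ≤ b)
    (i₀ : Fin (n + 1)) :
    ∃ (U : Finset (Fin m)) (O : Finset (Fin n)), F ⊆ O ∧ coordVars i₀ ⊆ O ∧ scopeVars I U ⊆ O ∧
      tightClosure t s I F ⊆ U ∧ U.card ≤ s ∧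
      ∀ V E : Finset (Fin n), V.card ≤ b → V ⊆ O ∪ E → E.card ≤ 1 →
        (E.Nonempty → ∃ v ∈ scopeVars I (tightClosure t s I V \ U), v ∈ O) →
        tightClosure t s I V ⊆ U := by
  classical
  set F' := F ∪ coordVars i₀ with hF'
  have hF'card : F'.card ≤ F.card + 1 :=
    (card_union_le _ _).trans (Nat.add_le_add_left (card_coordVars_le i₀) _)
  set C := tightClosure t s I F
  have hFb : F.card ≤ b := by omega
  -- The potential is 2|vars(U) ∪ F'| - (2k - t)|U|; its value at the empty set is at most 2(|F| +
  -- 1). With expansion, membership forces ε|U| ≤ 2b, so by `size` a further closure can be joined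
  -- without exceeding `s`.
  let fam : Finset (Finset (Fin m)) := univ.filter fun U => C ⊆ U ∧ U.card ≤ s ∧
    2 * (scopeVars I U ∪ F').card + t * U.card ≤ 2 * k * U.card + 2 * (F.card + 1)
  have hmem : ∀ U, U ∈ fam ↔ C ⊆ U ∧ U.card ≤ s ∧
      2 * (scopeVars I U ∪ F').card + t * U.card ≤ 2 * k * U.card + 2 * (F.card + 1) := by
    intro U; simp [fam]
  have hCfam : C ∈ fam := by
    refine (hmem C).2 ⟨Subset.rfl, H.card_closure_le hFb, ?_⟩
    have h1 := card_new_vars_le ((H.closure_spec hFb).1.mono (subset_union_left : F ⊆ F'))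
    have h2 : (scopeVars I C ∪ F').card ≤ (scopeVars I C \ F').card + F'.card := by
      rw [← sdiff_union_self_eq_union]; exact card_union_le _ _
    change 2 * (scopeVars I C \ F').card + _ + t * C.card ≤ 2 * k * C.card at h1
    omega
  obtain ⟨U, hU, hmax⟩ := exists_max_image fam card ⟨C, hCfam⟩
  obtain ⟨hCU, hUs, hUp⟩ := (hmem U).1 hU
  have hUcard : ε * U.card ≤ 2 * b := by
    have h1 := H.expanding U hUs
    have h2 : 2 * (scopeVars I U).card + t * U.card ≤ 2 * k * U.card + 2 * b := by
      have := card_le_card (subset_union_left : scopeVars I U ⊆ scopeVars I U ∪ F')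
      omega
    have h3 : (2 * (scopeVars I U).card + t * U.card : ℝ) ≤ 2 * k * U.card + 2 * b := by
      exact_mod_cast h2
    linarith
  refine ⟨U, scopeVars I U ∪ F', subset_union_left.trans subset_union_right,
    subset_union_right.trans subset_union_right, subset_union_left, hCU, hUs, ?_⟩
  intro V E hV hVE hE htouch
  obtain ⟨hA, hAcard⟩ := H.closure_spec hV
  set A := tightClosure t s I V
  have hgrow := card_union_vars_le hA hVE subset_union_left hE htouch
  have hUA : U ∪ A ∈ fam := by
    refine (hmem _).2 ⟨hCU.trans subset_union_left, ?_, ?_⟩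
    · refine H.card_le_of_mul_le ?_
      have h1 : ((U ∪ A).card : ℝ) ≤ U.card + A.card := by exact_mod_cast card_union_le _ _
      have := H.eps_pos
      nlinarith
    · have h1 : scopeVars I (U ∪ A) ∪ F' = scopeVars I (A \ U) ∪ (scopeVars I U ∪ F') := by
        rw [union_comm U, ← sdiff_union_self_eq_union (s := A), scopeVars_union, union_assoc]
      have h2 : (U ∪ A).card = U.card + (A \ U).card := by
        rw [← union_sdiff_self_eq_union, card_union_of_disjoint disjoint_sdiff]
      rw [h1, h2, mul_add, mul_add]
      omega
  have := hmax _ hUA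
  have he : U = U ∪ A := eq_of_subset_of_card_le subset_union_left this
  rw [he]
  exact subset_union_right

lemma card_union_coordVars_le (hF : F.card + 2 ≤ b) (i j : Fin (n + 1)) :
    (F ∪ coordVars i ∪ coordVars j).card ≤ b := by
  have h1 := card_union_le (F ∪ coordVars i) (coordVars j)
  have h2 := card_union_le F (coordVars i)
  have h3 := card_coordVars_le i
  have h4 := card_coordVars_le j
  omega

lemma Consistent.momentMatrix_eq (H : Consistent t ε s b μ I) (hF : F.card + 2 ≤ b)
    (hh : DependsOn h (F : Set (Fin n))) {i j : Fin (n + 1)} {U : Finset (Fin m)}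
    (hU : tightClosure t s I (F ∪ coordVars i ∪ coordVars j) ⊆ U) (hs : U.card ≤ s) :
    momentMatrix t s μ I F h i j
      = ∑ x, h x * homogCoord x i * homogCoord x j * weight μ I U x :=
  (H.sum_eq_localSum (card_union_coordVars_le hF i j)
    (dependsOn_mul_coord (dependsOn_mul_coord hh i) j) hU hs).symm

/-- All four entries can be computed with the closure of the largest variable set. Its weight
factors into a part on `O` and a part off `O`, so the two coordinates are independent. -/
lemma Consistent.covariance_eq_zero (H : Consistent t ε s b μ I) (hF : F.card + 2 ≤ b)
    (hh : DependsOn h (F : Set (Fin n))) {U : Finset (Fin m)} {O : Finset (Fin n)} (hFO : F ⊆ O)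
    (hUO : scopeVars I U ⊆ O) {i j : Fin (n + 1)} (hi : coordVars i ⊆ O)
    (hj : Disjoint (coordVars j) O)
    (hB : Disjoint (scopeVars I (tightClosure t s I (F ∪ coordVars i ∪ coordVars j) \ U)) O) :
    momentMatrix t s μ I F h 0 0 * momentMatrix t s μ I F h i j
      = momentMatrix t s μ I F h i 0 * momentMatrix t s μ I F h j 0 := by
  classical
  set A := tightClosure t s I (F ∪ coordVars i ∪ coordVars j) with hA
  have hAs : A.card ≤ s := H.card_closure_le (card_union_coordVars_le hF i j)
  have hw : ∀ x, weight μ I A x = weight μ I (A ∩ U) x * weight μ I (A \ U) x := by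
    intro x
    rw [weight, weight, weight, ← prod_union (disjoint_sdiff_inter A U).symm, union_comm,
      sdiff_union_inter]
  have hfin : ∀ {i' j' : Fin (n + 1)},
      F ∪ coordVars i' ∪ coordVars j' ⊆ F ∪ coordVars i ∪ coordVars j →
      momentMatrix t s μ I F h i' j'
        = ∑ x, h x * homogCoord x i' * homogCoord x j' * weight μ I A x :=
    fun hsub => H.momentMatrix_eq hF hh (tightClosure_mono hsub) hAs
  have e1 := hfin (i' := 0) (j' := 0) (by
    simp only [coordVars_zero, union_empty, union_assoc]; exact subset_union_left)
  have e2 := hfin (i' := i) (j' := j) Subset.rfl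
  have e3 := hfin (i' := i) (j' := 0) (by
    simp only [coordVars_zero, union_empty]; exact subset_union_left)
  have e4 := hfin (i' := j) (j' := 0) (by
    simp only [coordVars_zero, union_empty]
    exact union_subset_union_left subset_union_left)
  have hdw : DependsOn (weight μ I (A ∩ U)) (O : Set (Fin n)) :=
    (dependsOn_weight _).mono (coe_subset.2 ((scopeVars_mono inter_subset_right).trans hUO))
  have hdB : DependsOn (weight μ I (A \ U)) (O : Set (Fin n))ᶜ :=
    (dependsOn_weight _).mono fun v hv hvO => disjoint_left.1 hB hv hvO
  have key := sum_mul_sum_swap (O := O)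
    (f := fun x => h x * homogCoord x i * weight μ I (A ∩ U) x)
    (f' := fun x => h x * weight μ I (A ∩ U) x) (g := weight μ I (A \ U))
    (g' := fun x => homogCoord x j * weight μ I (A \ U) x)
    (fun x y hxy => by
      have d1 := hh fun v hv => hxy v (hFO hv)
      have d2 := homogCoord_congr (x := x) (y := y) i fun v hv => hxy v (hi hv)
      have d3 := hdw hxy
      simp only [d1, d2, d3])
    (fun x y hxy => by
      have d1 := hh fun v hv => hxy v (hFO hv)
      have d3 := hdw hxy
      simp only [d1, d3])
    hdB
    (fun x y hxy => by
      have d2 := homogCoord_congr (x := x) (y := y) j fun v hv =>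
        hxy v fun hvO => disjoint_left.1 hj hv hvO
      have d3 := hdB hxy
      simp only [d2, d3])
  rw [e1, e2, e3, e4]
  simp only [hw, homogCoord_zero, mul_one]
  rw [mul_comm]
  convert key.symm using 3 with x _ x _ <;> ring

/-- Cauchy–Schwarz for the unnormalized weight `w`. -/
lemma sum_sum_covariance_nonneg {ι κ : Type*} [Fintype ι] (Q : Finset κ) (a : κ → ℝ) {w : ι → ℝ}
    (hw : ∀ x, 0 ≤ w x) (f : ι → κ → ℝ) :
    0 ≤ ∑ i ∈ Q, ∑ j ∈ Q, a i * a j * ((∑ x, w x) * (∑ x, w x * f x i * f x j)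
      - (∑ x, w x * f x i) * ∑ x, w x * f x j) := by
  have h1 : (∑ x, w x * ∑ i ∈ Q, a i * f x i) ^ 2
      ≤ (∑ x, w x) * ∑ x, w x * (∑ i ∈ Q, a i * f x i) ^ 2 :=
    sum_sq_le_sum_mul_sum_of_sq_le_mul _ (fun x _ => hw x)
      (fun x _ => mul_nonneg (hw x) (sq_nonneg _)) fun x _ => by
        rw [mul_pow, sq (w x), mul_assoc]
  have h2 : ∑ x, w x * ∑ i ∈ Q, a i * f x i = ∑ i ∈ Q, a i * ∑ x, w x * f x i := by
    simp only [mul_sum]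
    rw [sum_comm]
    exact sum_congr rfl fun i _ => sum_congr rfl fun x _ => by ring
  have h3 : ∑ x, w x * (∑ i ∈ Q, a i * f x i) ^ 2
      = ∑ i ∈ Q, ∑ j ∈ Q, a i * a j * ∑ x, w x * f x i * f x j := by
    simp only [sq, sum_mul_sum]
    simp only [mul_sum]
    rw [sum_comm]
    refine sum_congr rfl fun i _ => ?_
    rw [sum_comm]
    exact sum_congr rfl fun j _ => sum_congr rfl fun x _ => by ring
  rw [h2, h3, sq, sum_mul_sum, mul_sum] at h1
  refine (sub_nonneg.2 h1).trans_eq ?_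
  rw [← sum_sub_distrib]
  refine sum_congr rfl fun i _ => ?_
  rw [mul_sum, ← sum_sub_distrib]
  exact sum_congr rfl fun j _ => by ring

lemma Consistent.posSemidef (H : Consistent t ε s b μ I) (hF : F.card + 2 ≤ b)
    (hh : DependsOn h (F : Set (Fin n))) (h0 : ∀ x, 0 ≤ h x)
    (hpos : 0 < momentMatrix t s μ I F h 0 0) : (momentMatrix t s μ I F h).PosSemidef := by
  classical
  set M := momentMatrix t s μ I F h with hM
  have hcov : ∀ a : Fin (n + 1) → ℝ,
      0 ≤ ∑ i, ∑ j, a i * a j * (M 0 0 * M i j - M i 0 * M j 0) := by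
    refine quadForm_nonneg_of_blocks (fun i j => ?_) fun i₀ => ?_
    · rw [hM, momentMatrix_comm i j]; ring
    obtain ⟨U, O, hFO, hi₀, hUO, -, hUs, hcl⟩ := H.exists_block hF i₀
    -- Index 0 has no variable, so it lies in every block. An index outside the block has exactly
    -- one variable, and that variable is not in `O`.
    refine ⟨univ.filter fun i => coordVars i ⊆ O, by simp [hi₀], ?_, fun a => ?_⟩
    · intro i hi j hj
      simp only [mem_filter, mem_univ, true_and] at hi hj
      have hjO : Disjoint (coordVars j) O := by
        refine disjoint_left.2 fun v hv hvO => hj fun w hw => ?_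
        rw [card_le_one.1 (card_coordVars_le j) w hw v hv]
        exact hvO
      refine sub_eq_zero.2 (H.covariance_eq_zero hF hh hFO hUO hi hjO ?_)
      refine disjoint_left.2 fun v hv hvO => ?_
      -- If the leftover constraints touched `O`, maximality would absorb the whole closure into
      -- `U`, leaving no leftover.
      have hsub := hcl _ (coordVars j) (card_union_coordVars_le hF i j)
        (union_subset_union_left (union_subset hFO hi)) (card_coordVars_le j)
        fun _ => ⟨v, hv, hvO⟩
      rw [sdiff_eq_empty_iff_subset.2 hsub] at hv
      simp [scopeVars] at hv
    · have hval : ∀ i j, coordVars i ⊆ O → coordVars j ⊆ O → M i j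
          = ∑ x, h x * homogCoord x i * homogCoord x j * weight μ I U x := by
        intro i j hi hj
        refine H.momentMatrix_eq hF hh (hcl _ ∅ (card_union_coordVars_le hF i j) ?_ (by simp)
          (by simp)) hUs
        rw [union_empty]
        exact union_subset (union_subset hFO hi) hj
      have hc0 : (coordVars 0 : Finset (Fin n)) ⊆ O := by simp [coordVars_zero]
      refine (sum_sum_covariance_nonneg (univ.filter fun i => coordVars i ⊆ O) a
        (w := fun x => h x * weight μ I U x) (fun x => mul_nonneg (h0 x)
          (weight_nonneg H.unif U x)) homogCoord).trans_eq ?_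
      refine sum_congr rfl fun i hi => sum_congr rfl fun j hj => ?_
      simp only [mem_filter, mem_univ, true_and] at hi hj
      rw [hval 0 0 hc0 hc0, hval i j hi hj, hval i 0 hi hc0, hval j 0 hj hc0]
      simp only [homogCoord_zero, mul_one, mul_right_comm _ (weight μ I U _)]
  refine Matrix.PosSemidef.of_dotProduct_mulVec_nonneg ?_ fun a => ?_
  · ext i j
    simp only [Matrix.conjTranspose_apply, star_trivial]
    exact momentMatrix_comm j i
  · have h1 : star a ⬝ᵥ M.mulVec a = ∑ i, ∑ j, a i * a j * M i j := by
      simp only [dotProduct, Matrix.mulVec, star_trivial, mul_sum]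
      exact sum_congr rfl fun i _ => sum_congr rfl fun j _ => by ring
    have h2 : M 0 0 * ∑ i, ∑ j, a i * a j * M i j
        = ∑ i, ∑ j, a i * a j * (M 0 0 * M i j - M i 0 * M j 0) + (∑ i, a i * M i 0) ^ 2 := by
      rw [sq, sum_mul_sum, mul_sum, ← sum_add_distrib]
      refine sum_congr rfl fun i _ => ?_
      rw [mul_sum, ← sum_add_distrib]
      exact sum_congr rfl fun j _ => by ring
    rw [h1]
    refine nonneg_of_mul_nonneg_right ?_ hpos
    rw [h2]
    exact add_nonneg (hcov a) (sq_nonneg _)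

end PseudoExpectation

/-! ### Protection matrices and iteration of the rounds. -/

section LovaszSchrijver

variable {k n m : ℕ}

/-- The vector of local expectations of the variables under the weight `h`. -/
noncomputable def localPoint (t s : ℕ) (μ : (Fin k → Bool) → ℝ) (I : Instance k n m)
    (F : Finset (Fin n)) (h : (Fin n → Bool) → ℝ) : Fin n → ℝ :=
  fun v => momentMatrix t s μ I F h v.succ 0 / momentMatrix t s μ I F h 0 0

variable {I : Instance k n m} {t s b : ℕ} {ε : ℝ} {μ : (Fin k → Bool) → ℝ}
  {F : Finset (Fin n)} {h : (Fin n → Bool) → ℝ}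

lemma cons_localPoint (hpos : 0 < momentMatrix t s μ I F h 0 0) (i : Fin (n + 1)) :
    (Fin.cons 1 (localPoint t s μ I F h) : Fin (n + 1) → ℝ) i
      = momentMatrix t s μ I F h i 0 / momentMatrix t s μ I F h 0 0 := by
  refine Fin.cases ?_ (fun v => rfl) i
  rw [Fin.cons_zero, div_self hpos.ne']

namespace Consistent

lemma momentMatrix_zero_nonneg (H : Consistent t ε s b μ I) (h0 : ∀ x, 0 ≤ h x)
    (i : Fin (n + 1)) : 0 ≤ momentMatrix t s μ I F h i 0 :=
  H.localSum_nonneg fun x =>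
    mul_nonneg (mul_nonneg (h0 x) (homogCoord_nonneg x i)) (homogCoord_nonneg x 0)

lemma momentMatrix_zero_le (H : Consistent t ε s b μ I) (hF : F.card + 2 ≤ b)
    (hh : DependsOn h (F : Set (Fin n))) (h0 : ∀ x, 0 ≤ h x) (i : Fin (n + 1)) :
    momentMatrix t s μ I F h i 0 ≤ momentMatrix t s μ I F h 0 0 := by
  rw [momentMatrix_zero_zero, ← H.localSum_eq (card_union_coordVars_le hF i 0)
    (subset_union_left.trans subset_union_left) hh]
  refine H.localSum_mono fun x => ?_
  rw [homogCoord_zero, mul_one]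
  exact mul_le_of_le_one_right (h0 x) (homogCoord_le_one x i)

lemma momentMatrix_mul_coord (i j : Fin (n + 1)) :
    momentMatrix t s μ I (F ∪ coordVars i) (fun x => h x * homogCoord x i) j 0
      = momentMatrix t s μ I F h j i := by
  rw [momentMatrix_comm (F := F) j i]
  simp [momentMatrix, coordVars_zero, homogCoord_zero]

lemma momentMatrix_mul_one_sub_coord (H : Consistent t ε s b μ I) (hF : F.card + 2 ≤ b)
    (hh : DependsOn h (F : Set (Fin n))) (i j : Fin (n + 1)) :
    momentMatrix t s μ I (F ∪ coordVars i) (fun x => h x * (1 - homogCoord x i)) j 0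
      = momentMatrix t s μ I F h j 0 - momentMatrix t s μ I F h j i := by
  have h1 : momentMatrix t s μ I F h j 0
      = localSum t s μ I (F ∪ coordVars i ∪ coordVars j) fun x => h x * homogCoord x j := by
    rw [H.localSum_eq (card_union_coordVars_le hF i j)
      (union_subset_union_left subset_union_left) (dependsOn_mul_coord hh j)]
    simp [momentMatrix, coordVars_zero, homogCoord_zero]
  rw [h1, momentMatrix_comm j i]
  simp only [momentMatrix, coordVars_zero, homogCoord_zero, localSum, union_empty]
  rw [← sum_sub_distrib]
  exact sum_congr rfl fun x _ => by ring

/-- When the conditioning event has mass zero the whole column vanishes; it is then 0 times any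
point of `K`, which is why `K` must be nonempty. -/
lemma mem_homogCone (H : Consistent t ε s b μ I) (hF : F.card + 2 ≤ b)
    (hh : DependsOn h (F : Set (Fin n))) (h0 : ∀ x, 0 ≤ h x) {K : Set (Fin n → ℝ)}
    (hK : K.Nonempty) (hmem : 0 < momentMatrix t s μ I F h 0 0 → localPoint t s μ I F h ∈ K)
    {p : ℝ} (hp : 0 < p) : (fun i => momentMatrix t s μ I F h i 0 / p) ∈ homogCone K := by
  rcases (H.momentMatrix_zero_nonneg (F := F) h0 0).eq_or_lt with hz | hpos
  · obtain ⟨x, hx⟩ := hK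
    refine ⟨0, le_rfl, x, hx, ?_⟩
    funext i
    have h1 : momentMatrix t s μ I F h i 0 = 0 :=
      le_antisymm (hz ▸ H.momentMatrix_zero_le hF hh h0 i) (H.momentMatrix_zero_nonneg h0 i)
    simp [h1]
  · refine ⟨momentMatrix t s μ I F h 0 0 / p, by positivity, _, hmem hpos, ?_⟩
    funext i
    rw [Pi.smul_apply, cons_localPoint hpos, smul_eq_mul]
    field_simp

lemma localPoint_mem_linRelax (H : Consistent t ε s b μ I) {P : (Fin k → Bool) → Bool}
    (hP : ∀ z, μ z ≠ 0 → P z = true) (hF : F.card + k + 2 ≤ b)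
    (hh : DependsOn h (F : Set (Fin n))) (h0 : ∀ x, 0 ≤ h x)
    (hpos : 0 < momentMatrix t s μ I F h 0 0) : localPoint t s μ I F h ∈ linRelax P I := by
  classical
  refine ⟨fun v => ⟨div_nonneg (H.momentMatrix_zero_nonneg h0 _) hpos.le,
    div_le_one_of_le₀ (H.momentMatrix_zero_le (by omega) hh h0 _) hpos.le⟩, fun j f hf => ?_⟩
  set V := F ∪ univ.image (I j).2 with hV
  have hVb : V.card ≤ b := by
    have h1 := card_union_le F (univ.image (I j).2)
    have h2 : (univ.image (I j).2).card ≤ k := card_image_le.trans (by simp)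
    rw [hV]
    omega
  -- Including `j` leaves the local expectations unchanged but makes every assignment of positive
  -- weight satisfy constraint `j`. The extra ε in `size` pays for it.
  set U := insert j (tightClosure t s I V) with hU
  have hUs : U.card ≤ s := by
    refine H.card_le_of_mul_le ?_
    have h1 : (U.card : ℝ) ≤ (tightClosure t s I V).card + 1 := by
      exact_mod_cast card_insert_le _ _
    have h2 := (H.closure_spec hVb).2
    have h3 := H.eps_pos
    have h4 : (0 : ℝ) ≤ b := by positivity
    nlinarith
  have hval : ∀ i, F ∪ coordVars i ∪ coordVars 0 ⊆ V → momentMatrix t s μ I F h i 0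
      = ∑ x, h x * homogCoord x i * weight μ I U x := by
    intro i hi
    rw [H.momentMatrix_eq (by omega) hh ((tightClosure_mono hi).trans (subset_insert _ _)) hUs]
    simp [homogCoord_zero, hU]
  have hp := hval 0 (by simp [coordVars_zero, hV])
  have hq : ∀ q : Fin k, momentMatrix t s μ I F h ((I j).2 q).succ 0
      = ∑ x, h x * homogCoord x ((I j).2 q).succ * weight μ I U x := by
    intro q
    refine hval _ ?_
    simp only [coordVars_zero, union_empty, hV]
    refine union_subset_union_right ?_
    simp [coordVars]
  set p := momentMatrix t s μ I F h 0 0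
  have hlit : ∀ q, p * lit (localPoint t s μ I F h ((I j).2 q)) (xor ((I j).1 q) (f q))
      = ∑ x, h x * weight μ I U x
        * lit (homogCoord x ((I j).2 q).succ) (xor ((I j).1 q) (f q)) := by
    intro q
    have h1 : p * localPoint t s μ I F h ((I j).2 q)
        = ∑ x, h x * weight μ I U x * homogCoord x ((I j).2 q).succ := by
      rw [localPoint, mul_div_cancel₀ _ hpos.ne', hq]
      exact sum_congr rfl fun x _ => by ring
    unfold lit
    split_ifs
    · rw [mul_sub, h1, mul_one, hp, ← sum_sub_distrib]
      exact sum_congr rfl fun x _ => by rw [homogCoord_zero]; ring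
    · exact h1
  refine le_of_mul_le_mul_left ?_ hpos
  rw [mul_one, mul_sum, sum_congr rfl fun q _ => hlit q, sum_comm, hp]
  refine sum_le_sum fun x _ => ?_
  rw [← mul_sum, homogCoord_zero, mul_one]
  rcases (weight_nonneg H.unif U x).eq_or_lt with hz | hw
  · rw [← hz]; simp
  refine le_mul_of_one_le_right (mul_nonneg (h0 x) hw.le) ?_
  have hμ : μ (fun q => xor ((I j).1 q) (x ((I j).2 q))) ≠ 0 := by
    have := (prod_ne_zero_iff.1 hw.ne') j (mem_insert_self _ _)
    exact right_ne_zero_of_mul this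
  -- The planted pattern satisfies `P` and `f` does not, so they differ at some position; the
  -- literal there equals 1.
  obtain ⟨q, hne⟩ : ∃ q, xor ((I j).1 q) (x ((I j).2 q)) ≠ f q := by
    by_contra! hall
    rw [funext hall] at hμ
    exact absurd (hP f hμ) (by simp [hf])
  have hnn : ∀ q ∈ univ, 0 ≤ lit (homogCoord x ((I j).2 q).succ) (xor ((I j).1 q) (f q)) := by
    intro q _
    unfold lit
    split_ifs
    · exact sub_nonneg.2 (homogCoord_le_one _ _)
    · exact homogCoord_nonneg _ _
  refine le_trans ?_ (single_le_sum hnn (mem_univ q))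
  simp only [lit, homogCoord, Fin.cons_succ]
  revert hne
  cases (I j).1 q <;> cases x ((I j).2 q) <;> cases f q <;> simp

theorem localPoint_mem_iterate (H : Consistent t ε s b μ I) {P : (Fin k → Bool) → Bool}
    (hP : ∀ z, μ z ≠ 0 → P z = true) (r : ℕ) (hF : F.card + r + k + 2 ≤ b)
    (hh : DependsOn h (F : Set (Fin n))) (h0 : ∀ x, 0 ≤ h x)
    (hpos : 0 < momentMatrix t s μ I F h 0 0) :
    localPoint t s μ I F h ∈ NPlus^[r] (linRelax P I) := by
  induction r generalizing F h with
  | zero => exact H.localPoint_mem_linRelax hP (by omega) hh h0 hpos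
  | succ r ih =>
    rw [Function.iterate_succ_apply']
    set K := NPlus^[r] (linRelax P I)
    have hK : K.Nonempty := ⟨_, ih (by omega) hh h0 hpos⟩
    set M := momentMatrix t s μ I F h with hM
    have hcard : ∀ i : Fin (n + 1), (F ∪ coordVars i).card ≤ F.card + 1 := fun i =>
      (card_union_le _ _).trans (Nat.add_le_add_left (card_coordVars_le i) _)
    -- The protection matrix is the normalized moment matrix. Column `i` and its complement in
    -- column 0 are the moment vectors of `h` times the coordinate and times its complement.
    refine ⟨(M 0 0)⁻¹ • M, (H.posSemidef (by omega) hh h0 hpos).smul (inv_nonneg.2 hpos.le),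
      fun i => ?_, fun i => ⟨?_, ?_⟩⟩
    · rw [cons_localPoint hpos]
      simp only [Matrix.smul_apply, smul_eq_mul]
      refine ⟨?_, by rw [div_eq_inv_mul]⟩
      rw [div_eq_inv_mul]
      exact congrArg _ (momentMatrix_self i)
    · have hd := dependsOn_mul_coord hh i
      have hn : ∀ x, 0 ≤ h x * homogCoord x i := fun x =>
        mul_nonneg (h0 x) (homogCoord_nonneg x i)
      have := H.mem_homogCone (by have := hcard i; omega) hd hn hK
        (fun hp => ih (by have := hcard i; omega) hd hn hp) hpos
      simpa only [momentMatrix_mul_coord, div_eq_inv_mul, Matrix.smul_apply, smul_eq_mul] using this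
    · have hd : DependsOn (fun x => h x * (1 - homogCoord x i))
          ((F ∪ coordVars i : Finset (Fin n)) : Set (Fin n)) := fun x y hxy => by
        have e1 : h x = h y := hh fun v hv => hxy v (by simp [mem_coe.1 hv])
        have e2 := homogCoord_congr (x := x) (y := y) i fun v hv => hxy v (by simp [hv])
        simp only [e1, e2]
      have hn : ∀ x, 0 ≤ h x * (1 - homogCoord x i) := fun x =>
        mul_nonneg (h0 x) (sub_nonneg.2 (homogCoord_le_one x i))
      have := H.mem_homogCone (by have := hcard i; omega) hd hn hK
        (fun hp => ih (by have := hcard i; omega) hd hn hp) hpos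
      simp only [H.momentMatrix_mul_one_sub_coord (by omega : F.card + 2 ≤ b) hh, div_eq_inv_mul]
        at this
      simpa only [mul_sub, Matrix.smul_apply, smul_eq_mul] using this

theorem iterate_nonempty (H : Consistent t ε s b μ I) {P : (Fin k → Bool) → Bool}
    (hP : ∀ z, μ z ≠ 0 → P z = true) {r : ℕ} (hr : r + k + 2 ≤ b) :
    (NPlus^[r] (linRelax P I)).Nonempty := by
  refine ⟨localPoint t s μ I ∅ fun _ => 1, H.localPoint_mem_iterate hP r (by simpa using hr)
    (fun _ _ _ => rfl) (fun _ => zero_le_one) ?_⟩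
  -- A tight set over no variables has size at most 0 by expansion, so the total mass is that of the
  -- constant 1.
  have hc : tightClosure t s I ∅ = ∅ := by
    have h1 := (H.closure_spec (F := ∅) (by simp)).1
    have h2 := h1.card_le H.expanding (H.card_closure_le (F := ∅) (by simp))
    have h3 := H.eps_pos
    rw [card_empty, Nat.cast_zero, mul_zero] at h2
    have h4 : ((tightClosure t s I ∅).card : ℝ) ≤ 0 := nonpos_of_mul_nonpos_right h2 h3
    exact card_eq_zero.1 (by exact_mod_cast le_antisymm h4 (Nat.cast_nonneg _))
  rw [momentMatrix_zero_zero, localSum, hc]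
  simp [weight]

end Consistent

end LovaszSchrijver

/-! ### Union bound for the failure of expansion. -/

section Probability

variable {k n m : ℕ}

lemma instanceProb_eq (E : Instance k n m → Prop) [DecidablePred E] :
    instanceProb E = ((univ.filter E).card : ℝ) / Fintype.card (Instance k n m) := by
  rw [instanceProb, Nat.card_eq_fintype_card, Nat.card_eq_fintype_card, Fintype.card_subtype]

lemma instanceProb_le_one (E : Instance k n m → Prop) : instanceProb E ≤ 1 := by
  classical
  rw [instanceProb_eq]
  refine div_le_one_of_le₀ ?_ (Nat.cast_nonneg _)
  exact_mod_cast card_le_univ _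

lemma one_sub_instanceProb_le [NeZero n] {E G : Instance k n m → Prop} (h : ∀ I, G I → E I) :
    1 - instanceProb (fun I => ¬ G I) ≤ instanceProb E := by
  classical
  have hN : (0 : ℝ) < Fintype.card (Instance k n m) := by exact_mod_cast Fintype.card_pos
  have h1 : Fintype.card (Instance k n m) ≤
      (univ.filter fun I : Instance k n m => ¬ G I).card
        + (univ.filter fun I : Instance k n m => E I).card := by
    rw [← card_univ, ← card_union_add_card_inter]
    refine (card_le_card fun I _ => ?_).trans (Nat.le_add_right _ _)
    by_cases hG : G I <;> simp [hG, h]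
  rw [instanceProb_eq, instanceProb_eq, sub_le_iff_le_add, ← add_div, le_div_iff₀ hN, one_mul,
    add_comm]
  exact_mod_cast h1

/-- Prescribing the variables at the positions of `D` as copies of other positions. -/
lemma card_copies_mul_le (D : Finset (Fin m × Fin k)) (e : Fin m × Fin k → Fin m × Fin k)
    (he : ∀ d ∈ D, e d ∉ D) :
    (univ.filter fun I : Instance k n m =>
      ∀ d ∈ D, (I d.1).2 d.2 = (I (e d).1).2 (e d).2).card * n ^ D.card
      ≤ Fintype.card (Instance k n m) := by
  classical
  set G := univ.filter fun I : Instance k n m =>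
    ∀ d ∈ D, (I d.1).2 d.2 = (I (e d).1).2 (e d).2
  let φ : G × (D → Fin n) → Instance k n m := fun z c =>
    ((z.1.1 c).1, fun p => if h : (c, p) ∈ D then z.2 ⟨(c, p), h⟩ else (z.1.1 c).2 p)
  have hφ : Function.Injective φ := by
    rintro ⟨⟨I, hI⟩, g⟩ ⟨⟨J, hJ⟩, g'⟩ heq
    have hneg : ∀ c, (I c).1 = (J c).1 := fun c => by
      have : (φ (⟨I, hI⟩, g) c).1 = (φ (⟨J, hJ⟩, g') c).1 := by rw [heq]
      exact this
    have hvar : ∀ c p, (φ (⟨I, hI⟩, g) c).2 p = (φ (⟨J, hJ⟩, g') c).2 p := fun c p => by rw [heq]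
    have hoff : ∀ d, d ∉ D → (I d.1).2 d.2 = (J d.1).2 d.2 := by
      rintro ⟨c, p⟩ hd
      simpa [φ, hd] using hvar c p
    have hIJ : I = J := by
      funext c
      refine Prod.ext (hneg c) (funext fun p => ?_)
      by_cases hd : (c, p) ∈ D
      · have h1 := (mem_filter.1 hI).2 _ hd
        have h2 := (mem_filter.1 hJ).2 _ hd
        exact h1.trans ((hoff _ (he _ hd)).trans h2.symm)
      · exact hoff _ hd
    have hgg : g = g' := by
      funext ⟨⟨c, p⟩, hd⟩
      simpa [φ, hd] using hvar c p
    subst hIJ hgg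
    rfl
  have := Fintype.card_le_of_injective φ hφ
  simpa [Fintype.card_prod, Fintype.card_coe] using this

/-- A set of constraints with few distinct variables has many positions copying others. -/
lemma exists_copies (I : Instance k n m) (A : Finset (Fin m)) {q : ℕ}
    (hq : q + (scopeVars I A).card ≤ k * A.card) :
    ∃ D ∈ powersetCard q (A ×ˢ (univ : Finset (Fin k))),
      ∃ e ∈ Fintype.piFinset fun d : Fin m × Fin k =>
        if d ∈ D then A ×ˢ (univ : Finset (Fin k)) else {d},
      (∀ d ∈ D, e d ∉ D) ∧ ∀ d ∈ D, (I d.1).2 d.2 = (I (e d).1).2 (e d).2 := by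
  classical
  set Q := A ×ˢ (univ : Finset (Fin k)) with hQ
  have hrep : ∀ v ∈ scopeVars I A, ∃ d ∈ Q, (I d.1).2 d.2 = v := by
    intro v hv
    obtain ⟨c, hc, p, hp⟩ := mem_scopeVars.1 hv
    exact ⟨(c, p), by simp [hQ, hc], hp⟩
  choose rep hrepQ hrepv using hrep
  -- One representative position per variable; every other position copies a representative. Taking
  -- `e` to be the identity off `D` keeps the number of such maps finite and small.
  set R := (scopeVars I A).attach.image (fun v => rep v.1 v.2) with hR
  have hcard : q ≤ (Q \ R).card := by
    have h1 : R.card ≤ (scopeVars I A).card := card_image_le.trans_eq (card_attach ..)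
    have h2 := le_card_sdiff R Q
    have h3 : Q.card = k * A.card := by
      rw [hQ, card_product, card_univ, Fintype.card_fin, mul_comm]
    omega
  obtain ⟨D, hD, hDq⟩ := exists_subset_card_eq hcard
  have hDQ : ∀ d ∈ D, d ∈ Q ∧ d ∉ R := fun d hd => Finset.mem_sdiff.1 (hD hd)
  have hvar : ∀ d ∈ D, (I d.1).2 d.2 ∈ scopeVars I A := fun d hd =>
    scopeVars_mem (mem_product.1 (hDQ d hd).1).1 _
  refine ⟨D, mem_powersetCard.2 ⟨fun d hd => (hDQ d hd).1, hDq⟩,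
    fun d => if hd : d ∈ D then rep _ (hvar d hd) else d, ?_, ?_, ?_⟩
  · rw [Fintype.mem_piFinset]
    intro d
    by_cases hd : d ∈ D
    · simpa [hd] using hrepQ _ (hvar d hd)
    · simp [hd]
  · intro d hd hd'
    simp only [dif_pos hd] at hd'
    exact (hDQ _ hd').2 (mem_image.2 ⟨⟨_, hvar d hd⟩, mem_attach _ _, rfl⟩)
  · intro d hd
    simp only [dif_pos hd]
    exact (hrepv _ (hvar d hd)).symm

/-- Union bound over the copying positions, at most 2^(k|A|) choices, and over their sources, at
most (k|A|)^q choices. -/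
lemma card_few_vars_mul_le (A : Finset (Fin m)) (q : ℕ) :
    (univ.filter fun I : Instance k n m =>
      q + (scopeVars I A).card ≤ k * A.card).card * n ^ q
      ≤ 2 ^ (k * A.card) * (k * A.card) ^ q * Fintype.card (Instance k n m) := by
  classical
  set Q := A ×ˢ (univ : Finset (Fin k)) with hQ
  have hQc : Q.card = k * A.card := by
    rw [hQ, card_product, card_univ, Fintype.card_fin, mul_comm]
  set Es : Finset (Fin m × Fin k) → Finset (Fin m × Fin k → Fin m × Fin k) := fun D =>
    (Fintype.piFinset fun d => if d ∈ D then Q else {d}).filter fun e => ∀ d ∈ D, e d ∉ D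
  have hsub : (univ.filter fun I : Instance k n m => q + (scopeVars I A).card ≤ k * A.card)
      ⊆ (powersetCard q Q).biUnion fun D => (Es D).biUnion fun e =>
        univ.filter fun I : Instance k n m =>
          ∀ d ∈ D, (I d.1).2 d.2 = (I (e d).1).2 (e d).2 := by
    intro I hI
    obtain ⟨D, hD, e, he, h1, h2⟩ := exists_copies I A (mem_filter.1 hI).2
    refine mem_biUnion.2 ⟨D, hD, mem_biUnion.2 ⟨e, mem_filter.2 ⟨he, h1⟩, ?_⟩⟩
    simpa using h2
  calc _ ≤ (∑ D ∈ powersetCard q Q, ∑ e ∈ Es D, (univ.filter fun I : Instance k n m =>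
          ∀ d ∈ D, (I d.1).2 d.2 = (I (e d).1).2 (e d).2).card) * n ^ q :=
        Nat.mul_le_mul_right _ ((card_le_card hsub).trans (card_biUnion_le.trans
          (sum_le_sum fun D _ => card_biUnion_le)))
    _ = ∑ D ∈ powersetCard q Q, ∑ e ∈ Es D, (univ.filter fun I : Instance k n m =>
          ∀ d ∈ D, (I d.1).2 d.2 = (I (e d).1).2 (e d).2).card * n ^ q := by
        simp only [sum_mul]
    _ ≤ ∑ D ∈ powersetCard q Q, ∑ e ∈ Es D, Fintype.card (Instance k n m) := by
        refine sum_le_sum fun D hD => sum_le_sum fun e he => ?_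
        have := card_copies_mul_le (n := n) D e (mem_filter.1 he).2
        rwa [(mem_powersetCard.1 hD).2] at this
    _ ≤ ∑ D ∈ powersetCard q Q, (k * A.card) ^ q * Fintype.card (Instance k n m) := by
        refine sum_le_sum fun D hD => ?_
        rw [sum_const, smul_eq_mul]
        refine Nat.mul_le_mul_right _ ((card_filter_le _ _).trans_eq ?_)
        rw [Fintype.card_piFinset]
        have : ∀ d : Fin m × Fin k, (if d ∈ D then Q else {d}).card
            = if d ∈ D then k * A.card else 1 := by
          intro d; split_ifs <;> simp [hQc]
        simp only [this]
        rw [prod_ite_mem, univ_inter, prod_const, (mem_powersetCard.1 hD).2]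
    _ ≤ 2 ^ (k * A.card) * (k * A.card) ^ q * Fintype.card (Instance k n m) := by
        rw [sum_const, smul_eq_mul, card_powersetCard, hQc, mul_assoc]
        exact Nat.mul_le_mul_right _ (Nat.choose_le_two_pow _ _)

lemma card_not_expanding_le [NeZero n] {t : ℕ} {ε : ℝ} (hε : ε ≤ t) (A : Finset (Fin m)) :
    ((univ.filter fun I : Instance k n m =>
      (2 * (scopeVars I A).card : ℝ) < (2 * k - t + ε) * A.card).card : ℝ)
      ≤ 2 ^ (k * A.card) * ((k * A.card : ℝ) / n) ^ ((t - ε) / 2 * A.card)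
        * Fintype.card (Instance k n m) := by
  classical
  have hn : (0 : ℝ) < n := by exact_mod_cast Nat.pos_of_ne_zero (NeZero.ne n)
  have hy : 0 ≤ (t - ε) / 2 * A.card :=
    mul_nonneg (div_nonneg (sub_nonneg.2 hε) zero_le_two) (Nat.cast_nonneg _)
  have h2 : (1 : ℝ) ≤ 2 ^ (k * A.card) := one_le_pow₀ one_le_two
  -- For n ≤ k|A| the bound is at least the number of all instances. Otherwise the base is at most
  -- 1, so rounding the exponent up is harmless.
  rcases le_total (n : ℝ) (k * A.card) with hka | hka
  · have h1 : (1 : ℝ) ≤ ((k * A.card : ℝ) / n) ^ ((t - ε) / 2 * A.card) :=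
      Real.one_le_rpow ((one_le_div hn).2 hka) hy
    refine le_trans ?_ (le_mul_of_one_le_left (Nat.cast_nonneg _) (one_le_mul_of_one_le_of_one_le h2 h1))
    exact_mod_cast card_le_univ _
  · set q := ⌈(t - ε) / 2 * A.card⌉₊ with hq
    have hsub : (univ.filter fun I : Instance k n m =>
        (2 * (scopeVars I A).card : ℝ) < (2 * k - t + ε) * A.card)
        ⊆ univ.filter fun I : Instance k n m => q + (scopeVars I A).card ≤ k * A.card := by
      intro I hI
      rw [mem_filter] at hI ⊢
      refine ⟨hI.1, ?_⟩
      have h3 : (t - ε) / 2 * A.card ≤ (k * A.card : ℝ) - (scopeVars I A).card := by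
        nlinarith [hI.2]
      have h4 : (scopeVars I A).card ≤ k * A.card := by
        have : ((scopeVars I A).card : ℝ) ≤ k * A.card := by linarith
        exact_mod_cast this
      have h5 : q ≤ k * A.card - (scopeVars I A).card := by
        rw [hq, Nat.ceil_le, Nat.cast_sub h4]
        exact_mod_cast h3
      omega
    have h3 := card_few_vars_mul_le (n := n) (k := k) A q
    have h4 : ((univ.filter fun I : Instance k n m =>
        q + (scopeVars I A).card ≤ k * A.card).card : ℝ) * n ^ q
        ≤ 2 ^ (k * A.card) * (k * A.card) ^ q * Fintype.card (Instance k n m) := by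
      exact_mod_cast h3
    have h5 : (((k * A.card : ℝ)) / n) ^ q
        ≤ ((k * A.card : ℝ) / n) ^ ((t - ε) / 2 * A.card) := by
      rw [← Real.rpow_natCast]
      exact Real.rpow_le_rpow_of_exponent_ge' (by positivity) ((div_le_one hn).2 hka) hy
        (Nat.le_ceil _)
    calc _ ≤ ((univ.filter fun I : Instance k n m =>
          q + (scopeVars I A).card ≤ k * A.card).card : ℝ) := by exact_mod_cast card_le_card hsub
      _ ≤ 2 ^ (k * A.card) * ((k * A.card : ℝ) / n) ^ q * Fintype.card (Instance k n m) := by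
          rw [div_pow, ← mul_div_assoc, div_mul_eq_mul_div, le_div_iff₀ (by positivity)]
          exact h4
      _ ≤ _ := by gcongr

lemma instanceProb_not_expanding_le [NeZero n] {t : ℕ} {ε : ℝ} (hε : ε ≤ t) (s : ℕ) :
    instanceProb (fun I : Instance k n m => ¬ Expanding t ε s I)
      ≤ ∑ a ∈ Icc 1 s, (m.choose a : ℝ)
        * (2 ^ (k * a) * ((k * a : ℝ) / n) ^ ((t - ε) / 2 * a)) := by
  classical
  have hN : (0 : ℝ) < Fintype.card (Instance k n m) := by exact_mod_cast Fintype.card_pos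
  rw [instanceProb_eq, div_le_iff₀ hN, sum_mul]
  have hsub : (univ.filter fun I : Instance k n m => ¬ Expanding t ε s I)
      ⊆ (Icc 1 s).biUnion fun a => (powersetCard a univ).biUnion fun A =>
        univ.filter fun I : Instance k n m =>
          (2 * (scopeVars I A).card : ℝ) < (2 * k - t + ε) * A.card := by
    intro I hI
    have h1 := (mem_filter.1 hI).2
    unfold Expanding at h1
    push Not at h1
    obtain ⟨A, hA, hlt⟩ := h1
    refine mem_biUnion.2 ⟨A.card, mem_Icc.2 ⟨?_, hA⟩, mem_biUnion.2
      ⟨A, mem_powersetCard.2 ⟨subset_univ _, rfl⟩, mem_filter.2 ⟨mem_univ _, hlt⟩⟩⟩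
    rw [Nat.one_le_iff_ne_zero]
    intro h0
    rw [h0, Nat.cast_zero, mul_zero] at hlt
    exact absurd hlt (not_lt.2 (by positivity))
  calc ((univ.filter fun I : Instance k n m => ¬ Expanding t ε s I).card : ℝ)
      ≤ ∑ a ∈ Icc 1 s, ∑ A ∈ powersetCard a (univ : Finset (Fin m)),
          ((univ.filter fun I : Instance k n m =>
          (2 * (scopeVars I A).card : ℝ) < (2 * k - t + ε) * A.card).card : ℝ) := by
        exact_mod_cast (card_le_card hsub).trans (card_biUnion_le.trans
          (sum_le_sum fun a _ => card_biUnion_le))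
    _ ≤ ∑ a ∈ Icc 1 s, ∑ A ∈ powersetCard a (univ : Finset (Fin m)),
          2 ^ (k * a) * ((k * a : ℝ) / n) ^ ((t - ε) / 2 * a)
            * Fintype.card (Instance k n m) := by
        refine sum_le_sum fun a _ => sum_le_sum fun A hA => ?_
        obtain rfl : A.card = a := (mem_powersetCard.1 hA).2
        exact card_not_expanding_le hε A
    _ = _ := by
        refine sum_congr rfl fun a _ => ?_
        rw [sum_const, card_powersetCard, card_univ, Fintype.card_fin, nsmul_eq_mul]
        ring

end Probability

/-! ### Estimating the first-moment sum. -/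

section Asymptotics

lemma choose_le_exp_mul_div_pow {m a : ℕ} (ha : 1 ≤ a) :
    (m.choose a : ℝ) ≤ (Real.exp 1 * (m / a)) ^ a := by
  have ha' : (0 : ℝ) < a := by exact_mod_cast ha
  have h1 : (m.choose a : ℝ) ≤ (m : ℝ) ^ a / a.factorial := Nat.choose_le_pow_div a m
  have h2 := Real.pow_div_factorial_le_exp (a : ℝ) ha'.le a
  calc (m.choose a : ℝ) ≤ (m : ℝ) ^ a / a.factorial := h1
    _ = (m / a : ℝ) ^ a * ((a : ℝ) ^ a / a.factorial) := by
        rw [div_pow]; field_simp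
    _ ≤ (m / a : ℝ) ^ a * Real.exp a := by gcongr
    _ = (Real.exp 1 * (m / a)) ^ a := by
        rw [mul_pow, ← Real.exp_nat_mul, mul_one, mul_comm]

/-- The base of the first moment bound for sets of `a` constraints. -/
lemma moment_base_le {k n m t a : ℕ} {ε : ℝ} (hε : 0 < ε) (hn : 1 ≤ n) (ha : 1 ≤ a)
    (hm : (m : ℝ) ≤ (n : ℝ) ^ ((t : ℝ) / 2 - ε)) :
    Real.exp 1 * (m / a) * (2 ^ k * ((k * a : ℝ) / n) ^ (((t : ℝ) - ε) / 2))
      ≤ Real.exp 1 * 2 ^ k * (k : ℝ) ^ (((t : ℝ) - ε) / 2)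
        * ((a : ℝ) ^ (((t : ℝ) - 2) / 2) * (n : ℝ) ^ (-ε / 2)) := by
  have hn' : (0 : ℝ) < n := by exact_mod_cast hn
  have ha' : (1 : ℝ) ≤ a := by exact_mod_cast ha
  have ha0 : (0 : ℝ) < a := by linarith
  set y := ((t : ℝ) - ε) / 2 with hy
  have h1 : ((k * a : ℝ) / n) ^ y = (k : ℝ) ^ y * (a : ℝ) ^ y / (n : ℝ) ^ y := by
    rw [Real.div_rpow (by positivity) hn'.le, Real.mul_rpow (by positivity) ha0.le]
  have h2 : (a : ℝ) ^ y / a ≤ (a : ℝ) ^ (((t : ℝ) - 2) / 2) := by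
    rw [← Real.rpow_sub_one ha0.ne']
    exact Real.rpow_le_rpow_of_exponent_le ha' (by rw [hy]; linarith)
  have h3 : (m : ℝ) / (n : ℝ) ^ y ≤ (n : ℝ) ^ (-ε / 2) := by
    rw [div_le_iff₀ (by positivity), ← Real.rpow_add hn']
    refine hm.trans_eq ?_
    congr 1
    rw [hy]; ring
  calc _ = Real.exp 1 * 2 ^ k * (k : ℝ) ^ y * (((a : ℝ) ^ y / a) * ((m : ℝ) / (n : ℝ) ^ y)) := by
        rw [h1]; ring
    _ ≤ _ := by gcongr

/-- Below the expansion threshold, the probability of failing to expand vanishes. -/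
lemma tendsto_instanceProb_not_expanding {k t : ℕ} (ht : 3 ≤ t) {ε : ℝ} (hε : 0 < ε) :
    ∃ c' : ℝ, 0 < c' ∧ ∀ m : ℕ → ℕ,
      (∀ᶠ n : ℕ in atTop, (m n : ℝ) ≤ (n : ℝ) ^ ((t : ℝ) / 2 - ε)) →
      Tendsto (fun n : ℕ => instanceProb fun I : Instance k n (m n) =>
        ¬ Expanding t ε ⌊c' * (n : ℝ) ^ (ε / ((t : ℝ) - 2))⌋₊ I) atTop (𝓝 0) := by
  have ht' : (3 : ℝ) ≤ t := by exact_mod_cast ht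
  set β : ℝ := ((t : ℝ) - 2) / 2 with hβ
  have hβ0 : 0 < β := by rw [hβ]; linarith
  set K : ℝ := Real.exp 1 * 2 ^ k * (k : ℝ) ^ (((t : ℝ) - ε) / 2) with hK
  have hK0 : 0 ≤ K := by positivity
  -- Chosen so that the base `X` of the a-th term is at most 1/2 for every a ≤ s.
  set c' : ℝ := (1 / (2 * (K + 1))) ^ β⁻¹ with hc'
  have hc'0 : 0 < c' := by positivity
  have hKc : K * c' ^ β ≤ 1 / 2 := by
    rw [hc', Real.rpow_inv_rpow (by positivity) hβ0.ne', mul_one_div, div_le_div_iff₀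
      (by positivity) (by positivity)]
    linarith
  have hsum : Summable fun a : ℕ => (a : ℝ) ^ t * (1 / 2 : ℝ) ^ a :=
    summable_pow_mul_geometric_of_norm_lt_one t (by norm_num)
  set Z : ℝ := ∑' a : ℕ, (a : ℝ) ^ t * (1 / 2 : ℝ) ^ a with hZ
  have hZ0 : 0 ≤ Z := tsum_nonneg fun a => by positivity
  refine ⟨c', hc'0, fun m hm => ?_⟩
  have hlim : Tendsto (fun n : ℕ => 2 * K * Z * (n : ℝ) ^ (-ε / 2)) atTop (𝓝 0) := by
    have h1 : Tendsto (fun n : ℕ => (n : ℝ) ^ (-(ε / 2))) atTop (𝓝 0) :=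
      (tendsto_rpow_neg_atTop (by linarith)).comp tendsto_natCast_atTop_atTop
    simpa [neg_div] using h1.const_mul (2 * K * Z)
  refine tendsto_of_tendsto_of_tendsto_of_le_of_le' tendsto_const_nhds hlim
    (Eventually.of_forall fun n => by unfold instanceProb; positivity) ?_
  filter_upwards [hm, eventually_ge_atTop 2] with n hmn hn
  have hn0 : (0 : ℝ) < n := by exact_mod_cast (by omega : 0 < n)
  have : NeZero n := ⟨by omega⟩
  set s := ⌊c' * (n : ℝ) ^ (ε / ((t : ℝ) - 2))⌋₊ with hs
  rcases lt_or_ge (t : ℝ) ε with hlt | hle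
  -- A negative exponent leaves no constraints at all.
  · have hm0 : m n = 0 := by
      have h1 : (n : ℝ) ^ ((t : ℝ) / 2 - ε) < 1 :=
        Real.rpow_lt_one_of_one_lt_of_neg (by exact_mod_cast (by omega : 1 < n)) (by linarith)
      have h2 : (m n : ℝ) < 1 := hmn.trans_lt h1
      exact_mod_cast Nat.lt_one_iff.1 (by exact_mod_cast h2)
    have hempty : IsEmpty {I : Instance k n (m n) // ¬ Expanding t ε s I} := by
      refine ⟨fun ⟨I, hI⟩ => hI fun A _ => ?_⟩
      have hA : A.card = 0 := by
        have := card_le_univ A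
        rw [Fintype.card_fin] at this
        omega
      rw [hA, Nat.cast_zero, mul_zero]
      positivity
    have : instanceProb (fun I : Instance k n (m n) => ¬ Expanding t ε s I) = 0 := by
      rw [instanceProb, Nat.card_eq_zero.2 (Or.inl hempty)]
      simp
    rw [this]
    positivity
  refine (instanceProb_not_expanding_le hle s).trans ?_
  have hterm : ∀ a ∈ Icc 1 s, ((m n).choose a : ℝ)
      * (2 ^ (k * a) * ((k * a : ℝ) / n) ^ (((t : ℝ) - ε) / 2 * a))
      ≤ 2 * K * (n : ℝ) ^ (-ε / 2) * ((a : ℝ) ^ t * (1 / 2 : ℝ) ^ a) := by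
    intro a ha
    obtain ⟨ha1, has⟩ := mem_Icc.1 ha
    have ha' : (1 : ℝ) ≤ a := by exact_mod_cast ha1
    set X : ℝ := Real.exp 1 * (m n / a) * (2 ^ k * ((k * a : ℝ) / n) ^ (((t : ℝ) - ε) / 2))
      with hX
    have hX0 : 0 ≤ X := by positivity
    have hXle : X ≤ K * ((a : ℝ) ^ β * (n : ℝ) ^ (-ε / 2)) :=
      moment_base_le hε (by omega) ha1 hmn
    have h1 : ((m n).choose a : ℝ)
        * (2 ^ (k * a) * ((k * a : ℝ) / n) ^ (((t : ℝ) - ε) / 2 * a)) ≤ X ^ a := by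
      rw [hX, mul_pow, mul_pow (2 ^ k : ℝ), ← pow_mul, Real.rpow_mul_natCast (by positivity)]
      exact mul_le_mul_of_nonneg_right (choose_le_exp_mul_div_pow ha1) (by positivity)
    have h2 : X ≤ 1 / 2 := by
      refine hXle.trans (le_trans ?_ hKc)
      refine mul_le_mul_of_nonneg_left ?_ hK0
      have h3 : (a : ℝ) ≤ c' * (n : ℝ) ^ (ε / ((t : ℝ) - 2)) :=
        (Nat.cast_le.2 has).trans (Nat.floor_le (by positivity))
      have h4 : (a : ℝ) ^ β ≤ c' ^ β * (n : ℝ) ^ (ε / 2) := by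
        refine (Real.rpow_le_rpow (by positivity) h3 hβ0.le).trans_eq ?_
        rw [Real.mul_rpow hc'0.le (by positivity), ← Real.rpow_mul hn0.le]
        congr 2
        rw [hβ]
        have : (t : ℝ) - 2 ≠ 0 := by linarith
        field_simp
      calc (a : ℝ) ^ β * (n : ℝ) ^ (-ε / 2)
          ≤ c' ^ β * (n : ℝ) ^ (ε / 2) * (n : ℝ) ^ (-ε / 2) := by gcongr
        _ = c' ^ β := by
            rw [mul_assoc, ← Real.rpow_add hn0]
            simp [neg_div]
    have h5 : X ≤ K * ((a : ℝ) ^ t * (n : ℝ) ^ (-ε / 2)) := by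
      refine hXle.trans ?_
      have : (a : ℝ) ^ β ≤ (a : ℝ) ^ t := by
        rw [← Real.rpow_natCast]
        exact Real.rpow_le_rpow_of_exponent_le ha' (by rw [hβ]; linarith)
      gcongr
    -- One factor of `X ^ a` supplies the decay n^(-ε/2); the other a - 1 supply the geometric
    -- series, at the cost of a factor 2.
    obtain ⟨b, rfl⟩ : ∃ b, a = b + 1 := ⟨a - 1, by omega⟩
    refine h1.trans ?_
    rw [pow_succ]
    calc X ^ b * X ≤ (1 / 2) ^ b * (K * (((b + 1 : ℕ) : ℝ) ^ t * (n : ℝ) ^ (-ε / 2))) := by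
          gcongr
      _ = _ := by rw [pow_succ (1 / 2 : ℝ)]; ring
  refine (sum_le_sum hterm).trans ?_
  rw [← mul_sum]
  have h6 : ∑ a ∈ Icc 1 s, (a : ℝ) ^ t * (1 / 2 : ℝ) ^ a ≤ Z :=
    hsum.sum_le_tsum _ fun a _ => by positivity
  calc _ ≤ 2 * K * (n : ℝ) ^ (-ε / 2) * Z := by gcongr
    _ = _ := by ring

end Asymptotics

end RandomCSP

theorem theorem2 (k t : ℕ) (ht : 3 ≤ t) (P : (Fin k → Bool) → Bool)
    (hP : RandomCSP.UniformSupporting P (t - 1)) (ε : ℝ) (hε : 0 < ε) :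
    ∃ c : ℝ, 0 < c ∧
      ∀ m : ℕ → ℕ, (∀ᶠ n : ℕ in atTop, (m n : ℝ) ≤ (n : ℝ) ^ ((t : ℝ) / 2 - ε)) →
        Tendsto
          (fun n : ℕ => RandomCSP.instanceProb (fun I : RandomCSP.Instance k n (m n) =>
            ∀ r : ℕ, (r : ℝ) ≤ c * (n : ℝ) ^ (ε / ((t : ℝ) - 2)) →
              (RandomCSP.NPlus^[r] (RandomCSP.linRelax P I)).Nonempty))
          atTop (𝓝 1) := by
  obtain ⟨μ, hμ, hsupp⟩ := hP.exists_locallyUniform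
  obtain ⟨c', hc', hexp⟩ := RandomCSP.tendsto_instanceProb_not_expanding (k := k) ht hε
  have ht' : (3 : ℝ) ≤ t := by exact_mod_cast ht
  -- With this constant, 4r uses at most half of εc'n^(ε/(t-2)). For large n the other half covers
  -- 4(k + 2) + 2ε, where one ε comes from `size` and one from the floor.
  refine ⟨ε * c' / 8, by positivity, fun m hm => ?_⟩
  have hlow : Tendsto (fun n : ℕ => 1 - RandomCSP.instanceProb fun I : RandomCSP.Instance k n (m n) =>
      ¬ RandomCSP.Expanding t ε ⌊c' * (n : ℝ) ^ (ε / ((t : ℝ) - 2))⌋₊ I) atTop (𝓝 1) := by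
    simpa using (hexp m hm).const_sub 1
  have hbig : Tendsto (fun n : ℕ => ε * c' / 2 * (n : ℝ) ^ (ε / ((t : ℝ) - 2))) atTop atTop :=
    ((tendsto_rpow_atTop (div_pos hε (by linarith))).comp
      tendsto_natCast_atTop_atTop).const_mul_atTop (by positivity)
  refine tendsto_of_tendsto_of_tendsto_of_le_of_le' hlow tendsto_const_nhds ?_
    (Eventually.of_forall fun n => RandomCSP.instanceProb_le_one _)
  filter_upwards [hbig.eventually_ge_atTop (4 * (k + 2) + 2 * ε), eventually_ge_atTop 1]
    with n hn hn1
  have : NeZero n := ⟨by omega⟩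
  refine RandomCSP.one_sub_instanceProb_le fun I hI r hr => ?_
  set s := ⌊c' * (n : ℝ) ^ (ε / ((t : ℝ) - 2))⌋₊
  have hs : c' * (n : ℝ) ^ (ε / ((t : ℝ) - 2)) ≤ s + 1 := (Nat.lt_floor_add_one _).le
  have hcons : RandomCSP.Consistent t ε s (r + k + 2) μ I := by
    refine ⟨hμ, hε, hI, ?_⟩
    push_cast
    nlinarith [mul_le_mul_of_nonneg_left hs hε.le]
  exact hcons.iterate_nonempty hsupp le_rfl
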